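/- Let $p\ge 2$ be even, $q\ge 2$, $m=pq$, and let $H=G(m,p,2)\subseteq G=G(m,1,2)$ be the group of matrices $PD\in GL_2(\mathbb C)$ with $P$ a permutation matrix and $D$ a diagonal matrix whose entries are $m$-th roots of unity with $\det(D)^{q}=1$. It acts on $S=\mathbb C[x,y]=\mathrm{Sym}(\mathbb C^2)$ by linear substitutions; put $R=S^H$, and let $$z=\prod_{L}\alpha_L,\qquad \Delta=\prod_L\alpha_L^{e_L},$$ where $L$ runs over the reflecting hyperplanes of $H$, $\alpha_L$ is a (fixed) defining linear form of $L$, and $e_L$ is the order of the pointwise stabiliser of $L$ in $H$. For an irreducible representation $\chi$ of $H$ let $S_\chi\subseteq S$ be the isotypical component of type $\chi$, and $M_\chi=\mathrm{Coker}\bigl(z\colon S_\chi\to S_{\chi\otimes\det}\bigr)$, which maps to $S/(z)$ via the inclusion $S_{\chi\otimes\det}\subseteq S$. For $0\le a,b<m$, $a\ne b$, let $\langle a,b\rangle$ be the restriction to $H$ of the $2$-dimensional representation of $G$ given by the $m$-tuple of Young diagrams with one box in position $a$ and one box in position $b$: in the basis of standard tableaux, $\mathrm{diag}(u,v)$ acts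 by $\mathrm{diag}(u^av^b,u^bv^a)$ and the transposition swaps the two basis vectors. **Theorem.** (a) The ring $R$ is the polynomial ring $\mathbb C[\sigma_1,\sigma_2]$ with $\sigma_1=(xy)^q$, $\sigma_2=x^m+y^m$; the discriminant $\Delta$ lies in $R$ and equals $\sigma_1(\sigma_2^2-4\sigma_1^p)$ up to a non-zero constant. As a power series in $\sigma_1,\sigma_2$ it defines a $D_{p+2}$ singularity, that is, up to a formal change of coordinates and a unit it is $X^2Y+Y^{p+1}$. (b) Over $R/(\Delta)$ let $X_j$, $K_j$, $N_j$ be the cokernels of $$\begin{pmatrix}\sigma_2&2\sigma_1^{j}\\2\sigma_1^{p+1-j}&\sigma_1\sigma_2\end{pmatrix},\quad \begin{pmatrix}\sigma_2&2\sigma_1^{j}\\2\sigma_1^{p-j}&\sigma_2\end{pmatrix},\quad \begin{pmatrix}\sigma_1\sigma_2&-2\sigma_1^{j+1}\\-2\sigma_1^{p+1-j}&\sigma_1\sigma_2\end{pmatrix}$$ acting on column vectors, for $0\le j\le p$. These are Cohen–Macaulay modules over $R/(\Delta)$ (at every prime $P$ the localisation is zero or has depth $\dim (R/(\Delta))_P$).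 (c) In each of the following cases the $2$-dimensional representation of $H$ is irreducible, the map $M_\chi\to S/(z)$ is a split injection of $R$-modules, so that $M_\chi$ is a direct summand of $S/(z)$, and there is an isomorphism of $R$-modules (equivalently, of $R/(\Delta)$-modules): 1. $M_{\langle i,\,jq-1\rangle}\cong X_{p+1-j}^2$ for $1\le j\le p$ and $0\le i<q-1$; 2. $M_{\langle i,\,jq+r\rangle}\cong K_j^2$ for $0\le j\le p-1$, $j\ne p/2$, $0\le i,r<q-1$ and $i<jq+r$ (in particular $M_{\langle 0,\,jq\rangle}\cong K_j^2$ for $1\le j\le p-1$, $j\neq p/2$); 3. $M_{\langle q-1,\,(j+1)q-1\rangle}\cong N_j^2$ for $1\le j\le p-1$, $j\ne p/2$. -/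

import Mathlib

namespace ReflectionMCM

open MvPolynomial

/-! ### The group `G(m,p,n)` -/

/-- The complex reflection group `G(m,p,n)`: the matrices `P D`, where `P` is the permutation
matrix of `s` (so `P e_j = e_{s j}`) and `D = diag(d_1, …, d_n)` with `d_j ^ m = 1` for all `j` and
`det(D)^(m/p) = 1`. -/
def imprimitiveGroup (m p n : ℕ) : Subgroup (GL (Fin n) ℂ) where
  carrier := {g | ∃ (s : Equiv.Perm (Fin n)) (d : Fin n → ℂˣ),
    (∀ j, d j ^ m = 1) ∧ (∏ j, d j) ^ (m / p) = 1 ∧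
    ∀ i j, (g : Matrix (Fin n) (Fin n) ℂ) i j = if i = s j then (d j : ℂ) else 0}
  one_mem' := by
    refine ⟨1, 1, by simp, by simp, fun i j => ?_⟩
    rw [Units.val_one, Matrix.one_apply]
    exact ite_congr rfl (fun _ => rfl) (fun _ => rfl)
  mul_mem' := by
    rintro g h ⟨s, d, hd, hD, hg⟩ ⟨t, e, he, hE, hh⟩
    refine ⟨s * t, fun j => d (t j) * e j, fun j => by rw [mul_pow, hd, he, one_mul], ?_, ?_⟩
    · rw [Finset.prod_mul_distrib, Equiv.prod_comp t d, mul_pow, hD, hE, one_mul]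
    · intro i j
      have h1 : ((g * h : GL (Fin n) ℂ) : Matrix (Fin n) (Fin n) ℂ) i j =
          if i = s (t j) then (d (t j) : ℂ) * (e j : ℂ) else 0 := by
        simp [Matrix.mul_apply, hg, hh]
      rw [h1, Units.val_mul]
      exact ite_congr rfl (fun _ => rfl) (fun _ => rfl)
  inv_mem' := by
    rintro g ⟨s, d, hd, hD, hg⟩
    refine ⟨s⁻¹, fun j => (d (s⁻¹ j))⁻¹, fun j => by rw [inv_pow, hd, inv_one], ?_, ?_⟩
    · rw [Finset.prod_inv_distrib, Equiv.prod_comp s⁻¹ d, inv_pow, hD, inv_one]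
    · have key : (Matrix.of fun i j => if i = s⁻¹ j then (((d (s⁻¹ j))⁻¹ : ℂˣ) : ℂ) else 0) *
          (g : Matrix (Fin n) (Fin n) ℂ) = 1 := by
        ext i j
        simp [Matrix.mul_apply, hg, Matrix.one_apply]
      have h2 : ((g⁻¹ : GL (Fin n) ℂ) : Matrix (Fin n) (Fin n) ℂ) =
          Matrix.of fun i j => if i = s⁻¹ j then (((d (s⁻¹ j))⁻¹ : ℂˣ) : ℂ) else 0 := by
        rw [Matrix.coe_units_inv]
        exact Matrix.inv_eq_left_inv key
      intro i j
      rw [h2]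
      rfl

lemma imprimitiveGroup_le (m p n : ℕ) : imprimitiveGroup m p n ≤ imprimitiveGroup m 1 n := by
  rintro g ⟨s, d, hd, -, hg⟩
  refine ⟨s, d, hd, ?_, hg⟩
  rw [Nat.div_one, ← Finset.prod_pow]
  exact Finset.prod_eq_one fun j _ => hd j

/-! ### The action on the polynomial ring and the ring of invariants -/

/-- The action of a matrix `g` on `S = Sym(ℂⁿ) = ℂ[x_1, …, x_n]`, where `x_j` is the `j`-th standard
basis vector of `ℂⁿ`: the algebra map with `x_j ↦ g x_j = ∑ i, g_{ij} x_i`. -/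
noncomputable def linSubst {n : ℕ} (g : GL (Fin n) ℂ) :
    MvPolynomial (Fin n) ℂ →ₐ[ℂ] MvPolynomial (Fin n) ℂ :=
  aeval fun j => ∑ i, C ((g : Matrix (Fin n) (Fin n) ℂ) i j) * X i

/-- The representation of `G ⊆ GL_n(ℂ)` on `S = Sym(ℂⁿ)`. -/
noncomputable def symRep {n : ℕ} (G : Subgroup (GL (Fin n) ℂ)) :
    Representation ℂ G (MvPolynomial (Fin n) ℂ) where
  toFun g := (linSubst (g : GL (Fin n) ℂ)).toLinearMap
  map_one' := by
    have : linSubst (1 : GL (Fin n) ℂ) = AlgHom.id ℂ _ := by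
      refine MvPolynomial.algHom_ext fun j => ?_
      simp [linSubst, Matrix.one_apply]
    refine LinearMap.ext fun f => ?_
    change linSubst (1 : GL (Fin n) ℂ) f = f
    rw [this]
    rfl
  map_mul' g h := by
    have : linSubst ((g * h : G) : GL (Fin n) ℂ) =
        (linSubst (g : GL (Fin n) ℂ)).comp (linSubst (h : GL (Fin n) ℂ)) := by
      refine MvPolynomial.algHom_ext fun j => ?_
      simp only [linSubst, aeval_X, AlgHom.comp_apply, map_sum, map_mul, Subgroup.coe_mul,
        Units.val_mul, Matrix.mul_apply, algHom_C, Finset.mul_sum, Finset.sum_mul]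
      rw [Finset.sum_comm]
      refine Finset.sum_congr rfl fun i _ => Finset.sum_congr rfl fun k _ => ?_
      simp only [algebraMap_eq]
      ring
    rw [this]
    rfl

/-- The invariant ring `R = S^G`, as a subalgebra of `S`. -/
noncomputable def invariantSubalgebra {n : ℕ} (G : Subgroup (GL (Fin n) ℂ)) :
    Subalgebra ℂ (MvPolynomial (Fin n) ℂ) where
  carrier := {f | ∀ g : G, symRep G g f = f}
  mul_mem' := by
    intro a b ha hb g
    have h : symRep G g (a * b) = symRep G g a * symRep G g b :=
      map_mul (linSubst (g : GL (Fin n) ℂ)) a b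
    rw [h, ha g, hb g]
  add_mem' := by
    intro a b ha hb g
    rw [map_add, ha g, hb g]
  algebraMap_mem' := fun r g => (linSubst (g : GL (Fin n) ℂ)).commutes r

/-- The invariant ring `R = S^G`, as a type of its own (which keeps instance search fast). -/
def InvRing {n : ℕ} (G : Subgroup (GL (Fin n) ℂ)) : Type := invariantSubalgebra G

namespace InvRing

variable {n : ℕ} (G : Subgroup (GL (Fin n) ℂ))

noncomputable instance : CommRing (InvRing G) :=
  inferInstanceAs (CommRing (invariantSubalgebra G))

noncomputable instance : Algebra ℂ (InvRing G) :=
  inferInstanceAs (Algebra ℂ (invariantSubalgebra G))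

noncomputable instance : Algebra (InvRing G) (MvPolynomial (Fin n) ℂ) :=
  inferInstanceAs (Algebra (invariantSubalgebra G) (MvPolynomial (Fin n) ℂ))

instance : IsScalarTower ℂ (InvRing G) (MvPolynomial (Fin n) ℂ) :=
  inferInstanceAs (IsScalarTower ℂ (invariantSubalgebra G) (MvPolynomial (Fin n) ℂ))

/-- The inclusion `R ⊆ S`. -/
noncomputable def incl : InvRing G →ₐ[ℂ] MvPolynomial (Fin n) ℂ := (invariantSubalgebra G).val

end InvRing

/-! ### Reflection arrangement, `z` and the discriminant

`S = Sym(V)` is the ring of polynomial functions on `V^*`; we write the points of `V^*` as row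
vectors, on which `g` acts by `v ↦ v g`, so that `(g f)(v) = f(v g)`. -/

/-- The reflecting hyperplanes `A(G)`: the hyperplanes that are the fixed space of some `g ∈ G`. -/
def reflectingHyperplanes {n : ℕ} (G : Subgroup (GL (Fin n) ℂ)) :
    Set (Submodule ℂ (Fin n → ℂ)) :=
  {H | Module.finrank ℂ H + 1 = n ∧ ∃ g ∈ G, ∀ v : Fin n → ℂ,
    v ∈ H ↔ Matrix.vecMul v (g : Matrix (Fin n) (Fin n) ℂ) = v}

/-- `e_H`: the order of the subgroup of `G` that fixes `H` pointwise. -/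
noncomputable def fixerOrder {n : ℕ} (G : Subgroup (GL (Fin n) ℂ))
    (H : Submodule ℂ (Fin n → ℂ)) : ℕ :=
  Nat.card {g : GL (Fin n) ℂ //
    g ∈ G ∧ ∀ v ∈ H, Matrix.vecMul v (g : Matrix (Fin n) (Fin n) ℂ) = v}

/-- `f ∈ S` is a defining linear equation of the hyperplane `H`. -/
def IsDefiningForm {n : ℕ} (H : Submodule ℂ (Fin n → ℂ)) (f : MvPolynomial (Fin n) ℂ) : Prop :=
  (∃ a : Fin n → ℂ, f = ∑ i, C (a i) * X i) ∧ ∀ v : Fin n → ℂ, v ∈ H ↔ eval v f = 0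

/-- `z = ∏_{H ∈ A(G)} α_H`, the equation of the reduced hyperplane arrangement. -/
noncomputable def arrangementPoly {n : ℕ} (G : Subgroup (GL (Fin n) ℂ))
    (α : Submodule ℂ (Fin n → ℂ) → MvPolynomial (Fin n) ℂ) : MvPolynomial (Fin n) ℂ :=
  ∏ᶠ H ∈ reflectingHyperplanes G, α H

/-- The discriminant `∏_{H ∈ A(G)} α_H ^ e_H` of the group action. -/
noncomputable def discriminantPoly {n : ℕ} (G : Subgroup (GL (Fin n) ℂ))
    (α : Submodule ℂ (Fin n → ℂ) → MvPolynomial (Fin n) ℂ) : MvPolynomial (Fin n) ℂ :=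
  ∏ᶠ H ∈ reflectingHyperplanes G, α H ^ fixerOrder G H

/-! ### Isotypical components and the modules `M_χ` -/

section Isotypic

variable {n : ℕ} (G : Subgroup (GL (Fin n) ℂ)) {W : Type} [AddCommGroup W] [Module ℂ W]

/-- The isotypical component `S^G_χ` of `S` for an irreducible representation `ρ` with character
`χ`, as an `R`-submodule of `S`. It is the sum of the images of all `G`-equivariant maps `ρ → S`; as
`ρ` is irreducible, these images are `0` and the subrepresentations of `S` isomorphic to `ρ`. -/
noncomputable def isotypic (ρ : Representation ℂ G W) :
    Submodule (InvRing G) (MvPolynomial (Fin n) ℂ) where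
  carrier := ((⨆ f : Representation.IntertwiningMap ρ (symRep G), LinearMap.range f.toLinearMap :
    Submodule ℂ (MvPolynomial (Fin n) ℂ)) : Set (MvPolynomial (Fin n) ℂ))
  add_mem' := fun ha hb => Submodule.add_mem _ ha hb
  zero_mem' := Submodule.zero_mem _
  smul_mem' := by
    intro r x hx
    have h : (⨆ f : Representation.IntertwiningMap ρ (symRep G),
        LinearMap.range f.toLinearMap) ≤
        (⨆ f : Representation.IntertwiningMap ρ (symRep G),
          LinearMap.range f.toLinearMap).comap
          (LinearMap.mulLeft ℂ (InvRing.incl G r)) := by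
      refine iSup_le fun f => ?_
      rintro _ ⟨w, rfl⟩
      let f' : Representation.IntertwiningMap ρ (symRep G) :=
        ⟨(LinearMap.mulLeft ℂ (InvRing.incl G r)).comp f.toLinearMap, by
          intro g
          ext1 v
          have h1 : symRep G g (InvRing.incl G r * f.toLinearMap v) =
              symRep G g (InvRing.incl G r) * symRep G g (f.toLinearMap v) :=
            map_mul (linSubst (g : GL (Fin n) ℂ)) _ _
          have h2 : f.toLinearMap (ρ g v) = symRep G g (f.toLinearMap v) :=
            LinearMap.congr_fun (f.isIntertwining' g) v
          have h3 : symRep G g (InvRing.incl G r) = InvRing.incl G r := r.2 g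
          change InvRing.incl G r * f.toLinearMap (ρ g v) =
            symRep G g (InvRing.incl G r * f.toLinearMap v)
          rw [h1, h2, h3]⟩
      exact (le_iSup (fun f : Representation.IntertwiningMap ρ (symRep G) =>
        LinearMap.range f.toLinearMap) f') ⟨w, rfl⟩
    exact h hx

/-- The representation `ρ ⊗ det`. -/
noncomputable def detTwist (ρ : Representation ℂ G W) : Representation ℂ G W where
  toFun g := ((g : GL (Fin n) ℂ) : Matrix (Fin n) (Fin n) ℂ).det • ρ g
  map_one' := by simp
  map_mul' g h := by
    simp only [Subgroup.coe_mul, Units.val_mul, Matrix.det_mul, map_mul, smul_mul_smul_comm]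

/-- `M_χ`, the cokernel of the multiplication map `z : S^G_χ → S^G_{χ ⊗ det}`. -/
abbrev MMod (z : MvPolynomial (Fin n) ℂ) (ρ : Representation ℂ G W) : Type :=
  isotypic G (detTwist G ρ) ⧸
    ((isotypic G ρ).map (LinearMap.mulLeft (InvRing G) z)).comap
      (isotypic G (detTwist G ρ)).subtype

/-- The map `M_χ → S/(z)` induced by the inclusion `S^G_{χ ⊗ det} ⊆ S`. -/
noncomputable def MMod.toQuotient (z : MvPolynomial (Fin n) ℂ) (ρ : Representation ℂ G W) :
    MMod G z ρ →ₗ[InvRing G] (MvPolynomial (Fin n) ℂ ⧸ Ideal.span {z}) :=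
  Submodule.liftQ _
    ((Ideal.Quotient.mkₐ (InvRing G) (Ideal.span {z})).toLinearMap.comp
      (isotypic G (detTwist G ρ)).subtype)
    (by
      rintro ⟨x, hx⟩ ⟨y, -, hy⟩
      have hy' : z * y = x := hy
      change Ideal.Quotient.mk (Ideal.span {z}) x = 0
      rw [Ideal.Quotient.eq_zero_iff_mem, ← hy']
      exact Ideal.mul_mem_right _ _ (Ideal.mem_span_singleton_self z))

/-- `ρ` is irreducible, `M_ρ ≅ Q²` as `R`-modules, and `M_ρ → S/(z)` is a split injection of
`R`-modules, so that `M_ρ ≅ Q²` is a direct summand of `S/(z)`. -/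
def GivesSquareSummand (z : MvPolynomial (Fin n) ℂ) (ρ : Representation ℂ G W)
    (Q : Type) [AddCommGroup Q] [Module (InvRing G) Q] : Prop :=
  ρ.IsIrreducible ∧
  Nonempty (MMod G z ρ ≃ₗ[InvRing G] (Q × Q)) ∧
  ∃ π : (MvPolynomial (Fin n) ℂ ⧸ Ideal.span {z}) →ₗ[InvRing G] MMod G z ρ,
    π ∘ₗ MMod.toQuotient G z ρ = LinearMap.id

end Isotypic

/-! ### Two-dimensional representations of `G(m,1,2)` -/

/-- The matrix of `g ∈ G(m,1,2)` on the representation of the `m`-tuple of Young diagrams with one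
box in position `i` and one box in position `j`. The basis vector with index `k : Fin 2` is the
standard tableau with the letter `k + 1` in position `i` and the other letter in position `j`. Thus
`diag(a, b)` acts by `diag(a^i b^j, b^i a^j)`, and the transposition swaps the two tableaux. -/
noncomputable def boxMatrix (i j : ℕ) (g : Matrix (Fin 2) (Fin 2) ℂ) : Matrix (Fin 2) (Fin 2) ℂ :=
  open Classical in
  Matrix.of fun k l => if g k l = 0 then 0 else g k l ^ i * g k.rev l.rev ^ j

lemma boxMatrix_mul (m i j : ℕ) (g h : imprimitiveGroup m 1 2) :
    boxMatrix i j ((g * h : imprimitiveGroup m 1 2) : GL (Fin 2) ℂ) =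
      boxMatrix i j (g : GL (Fin 2) ℂ) * boxMatrix i j (h : GL (Fin 2) ℂ) := by
  obtain ⟨g, s, d, -, -, hg⟩ := g
  obtain ⟨h, t, e, -, -, hh⟩ := h
  have key : ∀ s : Equiv.Perm (Fin 2), s = 1 ∨ s = Equiv.swap 0 1 := by decide
  ext k l
  simp only [boxMatrix, Matrix.mul_apply, Matrix.of_apply, Subgroup.coe_mul, Units.val_mul, hg, hh,
    Fin.sum_univ_two]
  rcases key s with rfl | rfl <;> rcases key t with rfl | rfl <;> fin_cases k <;> fin_cases l <;>
    simp <;> ring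

/-- The representation of `G(m,1,2)` on the space of standard tableaux of the `m`-tuple of Young
diagrams with one box in position `i` and one box in position `j`. -/
noncomputable def boxRep (m i j : ℕ) :
    Representation ℂ (imprimitiveGroup m 1 2) (Fin 2 → ℂ) where
  toFun g := Matrix.toLin' (boxMatrix i j (g : GL (Fin 2) ℂ))
  map_one' := by
    have : boxMatrix i j (1 : Matrix (Fin 2) (Fin 2) ℂ) = 1 := by
      ext k l
      fin_cases k <;> fin_cases l <;> simp [boxMatrix]
    refine LinearMap.ext fun f => ?_
    simp [this]
  map_mul' g h := by
    rw [boxMatrix_mul, Matrix.toLin'_mul]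
    rfl

/-- The restriction of `boxRep m i j` to `G(m,p,2)`. -/
noncomputable def resBoxRep (m p i j : ℕ) :
    Representation ℂ (imprimitiveGroup m p 2) (Fin 2 → ℂ) :=
  (boxRep m i j).comp (Subgroup.inclusion (imprimitiveGroup_le m p 2))

/-! ### The modules `X_j`, `K_j`, `N_j` -/

section Cokernels

variable {A : Type} [CommRing A]

/-- The cokernel of a square matrix acting on column vectors. -/
abbrev Coker (φ : Matrix (Fin 2) (Fin 2) A) : Type :=
  (Fin 2 → A) ⧸ LinearMap.range φ.mulVecLin

/-- The matrix `ξ_j`. Here and below `s`, `t` stand for `σ₁`, `σ₂`. -/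
def xiMat (p : ℕ) (s t : A) (j : ℕ) : Matrix (Fin 2) (Fin 2) A :=
  !![t, 2 * s ^ j; 2 * s ^ (p + 1 - j), t * s]

/-- The matrix `φ_j`. -/
def phiMat (p : ℕ) (s t : A) (j : ℕ) : Matrix (Fin 2) (Fin 2) A :=
  !![t, 2 * s ^ j; 2 * s ^ (p - j), t]

/-- The matrix `ψ_j`. -/
def psiMat (p : ℕ) (s t : A) (j : ℕ) : Matrix (Fin 2) (Fin 2) A :=
  !![t * s, -2 * s ^ (j + 1); -2 * s ^ (p + 1 - j), t * s]

/-- `X_j = Coker ξ_j`. For `s = σ₁`, `t = σ₂` in `A = R/(Δ)` this is also the cokernel of `ξ_j` over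
`R`, because the latter is annihilated by `Δ`; similarly for `K_j` and `N_j`. -/
abbrev XMod (p : ℕ) (s t : A) (j : ℕ) : Type := Coker (xiMat p s t j)

/-- `K_j = Coker φ_j`. -/
abbrev KMod (p : ℕ) (s t : A) (j : ℕ) : Type := Coker (phiMat p s t j)

/-- `N_j = Coker ψ_j`. -/
abbrev NMod (p : ℕ) (s t : A) (j : ℕ) : Type := Coker (psiMat p s t j)

end Cokernels

/-! ### Cohen-Macaulay modules and `D_n` singularities -/

/-- (Maximal) Cohen-Macaulay modules over a Noetherian ring `A`: finitely generated, with
`depth M_P = dim A_P` for every prime `P` with `M_P ≠ 0`. Since `depth M_P ≤ dim A_P` if `M_P ≠ 0`,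
it is enough to ask for a weakly regular sequence of length `dim A_P` in the maximal ideal; by
Nakayama it is regular if `M_P ≠ 0`, and it always exists if `M_P = 0`. -/
def IsCohenMacaulayModule (A M : Type) [CommRing A] [AddCommGroup M] [Module A M] : Prop :=
  Module.Finite A M ∧ ∀ (P : Ideal A) [P.IsPrime],
    ∃ rs : List (Localization.AtPrime P),
      (∀ r ∈ rs, r ∈ IsLocalRing.maximalIdeal (Localization.AtPrime P)) ∧
      RingTheory.Sequence.IsWeaklyRegular (LocalizedModule P.primeCompl M) rs ∧
      (rs.length : WithBot ℕ∞) = ringKrullDim (Localization.AtPrime P)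

/-- The plane curve germ `f = 0` is a `D_n` singularity (`n ≥ 4`): up to a formal change of
coordinates and a unit, `f` is `X² Y + Y^(n-1)`. -/
def IsDSingularity (n : ℕ) (f : MvPowerSeries (Fin 2) ℂ) : Prop :=
  4 ≤ n ∧ ∃ (e : MvPowerSeries (Fin 2) ℂ ≃ₐ[ℂ] MvPowerSeries (Fin 2) ℂ)
    (u : (MvPowerSeries (Fin 2) ℂ)ˣ),
    e f = (u : MvPowerSeries (Fin 2) ℂ) * (MvPowerSeries.X 0 ^ 2 * MvPowerSeries.X 1 + MvPowerSeries.X 1 ^ (n - 1))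

end ReflectionMCM

open ReflectionMCM MvPolynomial

namespace ReflectionMCM

section CohenMacaulay

variable {R : Type} [CommRing R] [IsDomain R] {D : R}

/-- In a unique factorization domain, an element that is a zero divisor modulo `D` has a common
prime factor with `D`. -/
lemma exists_prime_dvd_of_mk_notMem_nonZeroDivisors [UniqueFactorizationMonoid R]
    (hD : D ≠ 0) {r : R}
    (hr : Ideal.Quotient.mk (Ideal.span {D}) r ∉ nonZeroDivisors (R ⧸ Ideal.span {D})) :
    ∃ f ∈ UniqueFactorizationMonoid.factors D, f ∣ r := by
  by_contra! h
  apply hr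
  rw [mem_nonZeroDivisors_iff_right]
  intro x hx
  obtain ⟨x, rfl⟩ := Ideal.Quotient.mk_surjective x
  rw [← map_mul, Ideal.Quotient.eq_zero_iff_dvd] at hx
  rw [Ideal.Quotient.eq_zero_iff_dvd]
  refine (UniqueFactorizationMonoid.dvd_of_dvd_mul_left_of_no_prime_factors hD ?_ hx)
  intro d hdD hdr hd
  obtain ⟨f, hf, hdf⟩ := UniqueFactorizationMonoid.exists_mem_factors_of_dvd hD hd.irreducible hdD
  exact h f hf (hdf.dvd_iff_dvd_left.1 hdr)

lemma exists_nonZeroDivisor_mem_of_notMem_minimalPrimes [UniqueFactorizationMonoid R]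
    [IsNoetherianRing R] (hD : D ≠ 0)
    (P : Ideal (R ⧸ Ideal.span {D})) [hP : P.IsPrime]
    (hmin : P ∉ minimalPrimes (R ⧸ Ideal.span {D})) :
    ∃ r ∈ P, r ∈ nonZeroDivisors (R ⧸ Ideal.span {D}) := by
  classical
  by_contra! h
  apply hmin
  set π := Ideal.Quotient.mk (Ideal.span {D}) with hπ
  have hsub : ((P.comap π : Ideal R) : Set R) ⊆
      ⋃ f ∈ ((UniqueFactorizationMonoid.factors D).toFinset : Set R),
        ((Ideal.span {f} : Ideal R) : Set R) := by
    intro r hr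
    obtain ⟨f, hf, hfr⟩ := exists_prime_dvd_of_mk_notMem_nonZeroDivisors hD (h _ hr)
    simp only [Set.mem_iUnion]
    exact ⟨f, by simpa using hf, Ideal.mem_span_singleton.2 hfr⟩
  have hprime : ∀ f ∈ UniqueFactorizationMonoid.factors D, Prime f := fun f hf =>
    UniqueFactorizationMonoid.prime_of_factor f hf
  obtain ⟨f, hf, hle⟩ := (Ideal.subset_union_prime 0 0 (fun f hf _ _ => by
    have := hprime f (by simpa using hf)
    exact (Ideal.span_singleton_prime this.ne_zero).2 this)).1 hsub
  have hf' := hprime f (by simpa using hf)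
  have hfp : (Ideal.span {f}).IsPrime := (Ideal.span_singleton_prime hf'.ne_zero).2 hf'
  have hht := Ideal.height_span_singleton_le_one hf'.not_isUnit
  have key : ∀ Q : Ideal (R ⧸ Ideal.span {D}), Q.IsPrime → Q ≤ P →
      Q.comap π = Ideal.span {f} := by
    intro Q hQ hQP
    refine ((Ideal.comap_mono hQP).trans hle).eq_of_not_lt fun hlt => ?_
    have h0 : (⊥ : Ideal R) < Q.comap π := by
      refine bot_lt_iff_ne_bot.2 fun hb => hD ?_
      rw [← Ideal.mem_bot, ← hb, Ideal.mem_comap, hπ, Ideal.Quotient.mk_singleton_self]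
      exact Q.zero_mem
    have := Ideal.IsPrime.comap π (K := Q)
    have h1 := Ideal.height_add_one_le_of_lt_of_isPrime h0
    have h2 := Ideal.height_add_one_le_of_lt_of_isPrime hlt
    rw [Ideal.height_bot, zero_add] at h1
    have h3 : (1 : ℕ∞) + 1 ≤ 1 := (add_le_add_left h1 1).trans (h2.trans hht)
    exact absurd h3 (by decide)
  refine ⟨⟨hP, bot_le⟩, fun Q hQ hQP => ?_⟩
  have := (key Q hQ.1 hQP).trans (key P hP le_rfl).symm
  exact (Ideal.comap_injective_of_surjective π Ideal.Quotient.mk_surjective this).ge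

lemma isSMulRegular_coker_of_matrixFactorization (hD : D ≠ 0) {φ ψ : Matrix (Fin 2) (Fin 2) R}
    (h₁ : φ * ψ = D • 1) (h₂ : ψ * φ = D • 1) {r : R ⧸ Ideal.span {D}}
    (hr : r ∈ nonZeroDivisors (R ⧸ Ideal.span {D})) :
    IsSMulRegular (Coker (φ.map (Ideal.Quotient.mk (Ideal.span {D})))) r := by
  set π := Ideal.Quotient.mk (Ideal.span {D}) with hπ
  rw [isSMulRegular_iff_right_eq_zero_of_smul]
  intro x hx
  obtain ⟨v, rfl⟩ := Submodule.Quotient.mk_surjective _ x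
  rw [← Submodule.Quotient.mk_smul, Submodule.Quotient.mk_eq_zero] at hx
  obtain ⟨w, hw⟩ := hx
  rw [Submodule.Quotient.mk_eq_zero]
  have hzero : ψ.map π * φ.map π = 0 := by
    rw [← Matrix.map_mul, h₂]
    ext i j
    by_cases hij : i = j <;> simp [hπ, hij]
  have h3 : r • (ψ.map π).mulVec v = 0 := by
    rw [← Matrix.mulVec_smul, ← hw, Matrix.mulVecLin_apply, Matrix.mulVec_mulVec, hzero,
      Matrix.zero_mulVec]
  have h4 : (ψ.map π).mulVec v = 0 := by
    ext i
    exact (mem_nonZeroDivisors_iff_right.1 hr) _ (by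
      have := congrFun h3 i
      rwa [Pi.smul_apply, smul_eq_mul, mul_comm] at this)
  choose u hu using fun i => Ideal.Quotient.mk_surjective (I := Ideal.span {D}) (v i)
  have h5 : ∀ i, ∃ c, ψ.mulVec u i = D * c := fun i => by
    have : π (ψ.mulVec u i) = 0 := by
      rw [RingHom.map_mulVec]
      have : π ∘ u = v := funext hu
      rw [this]
      exact congrFun h4 i
    exact (Ideal.Quotient.eq_zero_iff_dvd _ _).1 this
  choose c hc using h5
  have h6 : D • u = D • φ.mulVec c := by
    have h7 : ψ.mulVec u = D • c := funext fun i => by simpa using hc i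
    have := congrArg φ.mulVec h7
    rwa [Matrix.mulVec_mulVec, h₁, Matrix.mulVec_smul, Matrix.smul_mulVec,
      Matrix.one_mulVec] at this
  have h7 : u = φ.mulVec c := smul_right_injective _ hD h6
  refine ⟨π ∘ c, ?_⟩
  ext i
  rw [Matrix.mulVecLin_apply, ← hu, ← RingHom.map_mulVec, h7]

lemma isCohenMacaulayModule_coker [UniqueFactorizationMonoid R] [IsNoetherianRing R]
    (hdim : ringKrullDim R ≤ 2) (hD : D ≠ 0)
    {φ ψ : Matrix (Fin 2) (Fin 2) R} (h₁ : φ * ψ = D • 1) (h₂ : ψ * φ = D • 1) :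
    IsCohenMacaulayModule (R ⧸ Ideal.span {D})
      (Coker (φ.map (Ideal.Quotient.mk (Ideal.span {D})))) := by
  refine ⟨inferInstance, fun P hP => ?_⟩
  rw [IsLocalization.AtPrime.ringKrullDim_eq_height P]
  by_cases hmin : P ∈ minimalPrimes (R ⧸ Ideal.span {D})
  · refine ⟨[], by simp, RingTheory.Sequence.IsWeaklyRegular.nil _ _, ?_⟩
    rw [Ideal.height_eq_zero_iff.2 hmin]
    rfl
  · obtain ⟨r, hrP, hr⟩ := exists_nonZeroDivisor_mem_of_notMem_minimalPrimes hD P hmin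
    refine ⟨[algebraMap _ _ r], ?_, ?_, ?_⟩
    · simpa using (IsLocalization.AtPrime.to_map_mem_maximal_iff _ P r).2 hrP
    · rw [RingTheory.Sequence.isWeaklyRegular_singleton_iff]
      exact (isSMulRegular_coker_of_matrixFactorization hD h₁ h₂ hr).of_isLocalizedModule
        _ P.primeCompl (LocalizedModule.mkLinearMap P.primeCompl _)
    · have h1 : P.height ≠ 0 := fun h => hmin (Ideal.height_eq_zero_iff.1 h)
      have h2 : ringKrullDim (R ⧸ Ideal.span {D}) + 1 ≤ 2 :=
        (ringKrullDim_quotient_succ_le_of_nonZeroDivisor (mem_nonZeroDivisors_of_ne_zero hD)).trans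
          hdim
      have h3 : (P.height : WithBot ℕ∞) ≤ ringKrullDim (R ⧸ Ideal.span {D}) :=
        Ideal.height_le_ringKrullDim_of_isPrime
      have h4 : ((P.height + 1 : ℕ∞) : WithBot ℕ∞) ≤ ((2 : ℕ∞) : WithBot ℕ∞) := by
        push_cast
        exact (add_le_add_left h3 1).trans h2
      have h5 : P.height + 1 ≤ 1 + 1 := by
        rw [one_add_one_eq_two]
        exact WithBot.coe_le_coe.1 h4
      have h6 : P.height ≤ 1 := (ENat.add_le_add_iff_right (by simp)).1 h5
      have h7 : P.height = 1 := le_antisymm h6 (Order.one_le_iff_ne_zero.2 h1)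
      rw [h7]
      rfl

end CohenMacaulay

section DSingularity

/-- Rescaling the variables by units, as an automorphism of the power series ring. -/
noncomputable def rescaleEquiv {σ R : Type} [CommRing R] (a : σ → Rˣ) :
    MvPowerSeries σ R ≃ₐ[R] MvPowerSeries σ R :=
  AlgEquiv.ofAlgHom (MvPowerSeries.rescaleAlgHom fun i => (a i : R))
    (MvPowerSeries.rescaleAlgHom fun i => ((a i)⁻¹ : Rˣ))
    (by
      rw [← MvPowerSeries.rescaleAlgHom_mul, ← MvPowerSeries.rescaleAlgHom_one]
      congr 1
      ext i
      simp)
    (by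
      rw [← MvPowerSeries.rescaleAlgHom_mul, ← MvPowerSeries.rescaleAlgHom_one]
      congr 1
      ext i
      simp)

lemma rescaleEquiv_X {σ R : Type} [CommRing R] (a : σ → Rˣ) (i : σ) :
    rescaleEquiv a (MvPowerSeries.X i) = MvPowerSeries.C (a i : R) * MvPowerSeries.X i := by
  change MvPowerSeries.rescaleAlgHom _ _ = _
  rw [MvPowerSeries.rescaleAlgHom_apply, MvPowerSeries.rescale_eq_subst,
    MvPowerSeries.subst_X (MvPowerSeries.HasSubst.smul_X _), Pi.smul_apply',
    MvPowerSeries.smul_eq_C_mul]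

lemma isDSingularity_discriminant {p : ℕ} (hp : 2 ≤ p) {c : ℂ} (hc : c ≠ 0) :
    IsDSingularity (p + 2)
      ((C c * (X 0 * (X 1 ^ 2 - C 4 * X 0 ^ p)) : MvPolynomial (Fin 2) ℂ) :
        MvPowerSeries (Fin 2) ℂ) := by
  refine ⟨by omega, ?_⟩
  obtain ⟨l, hl⟩ := IsAlgClosed.exists_pow_nat_eq (-4⁻¹ : ℂ) (n := p) (by omega)
  have hl0 : l ≠ 0 := by
    rintro rfl
    rw [zero_pow (by omega)] at hl
    norm_num at hl
  refine ⟨(rescaleEquiv ![Units.mk0 l hl0, 1]).trans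
    (MvPowerSeries.renameEquiv ℂ (Equiv.swap 0 1)),
    Units.map (MvPowerSeries.C (σ := Fin 2) (R := ℂ)).toMonoidHom
      (Units.mk0 (c * l) (mul_ne_zero hc hl0)), ?_⟩
  have h0 : (MvPowerSeries.renameEquiv ℂ (Equiv.swap (0 : Fin 2) 1))
      (rescaleEquiv ![Units.mk0 l hl0, 1] (MvPowerSeries.X 0)) =
        MvPowerSeries.C l * MvPowerSeries.X 1 := by
    rw [rescaleEquiv_X, map_mul]
    congr 1
    · exact MvPowerSeries.rename_C _ _
    · exact (MvPowerSeries.rename_X _ _).trans (by simp)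
  have h1 : (MvPowerSeries.renameEquiv ℂ (Equiv.swap (0 : Fin 2) 1))
      (rescaleEquiv ![Units.mk0 l hl0, 1] (MvPowerSeries.X 1)) = MvPowerSeries.X 0 := by
    rw [rescaleEquiv_X, map_mul]
    have : (MvPowerSeries.renameEquiv ℂ (Equiv.swap (0 : Fin 2) 1)) (MvPowerSeries.X 1) =
      MvPowerSeries.X 0 := (MvPowerSeries.rename_X _ _).trans (by simp)
    rw [this]
    simp
  have hC : ∀ a : ℂ, (MvPowerSeries.renameEquiv ℂ (Equiv.swap (0 : Fin 2) 1))
      (rescaleEquiv ![Units.mk0 l hl0, 1] (MvPowerSeries.C a)) = MvPowerSeries.C a := fun a =>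
    ((rescaleEquiv ![Units.mk0 l hl0, 1]).trans
      (MvPowerSeries.renameEquiv ℂ (Equiv.swap (0 : Fin 2) 1))).commutes a
  have hsub : ∀ f g : MvPolynomial (Fin 2) ℂ,
      ((f - g : MvPolynomial (Fin 2) ℂ) : MvPowerSeries (Fin 2) ℂ) = f - g := fun f g =>
    map_sub (coeToMvPowerSeries.ringHom (σ := Fin 2) (R := ℂ)) f g
  rw [AlgEquiv.trans_apply]
  simp only [coe_mul, hsub, coe_X, coe_C, coe_pow, map_mul, map_sub, map_pow, h0, h1, hC]
  have h4 : (MvPowerSeries.C (σ := Fin 2) (4 : ℂ)) * MvPowerSeries.C l ^ p = -1 := by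
    rw [← map_pow, ← map_mul, hl, ← map_one (MvPowerSeries.C (σ := Fin 2) (R := ℂ)), ← map_neg]
    norm_num
  change _ = MvPowerSeries.C (c * l) * _
  rw [mul_pow, ← mul_assoc (MvPowerSeries.C (4 : ℂ)), h4, map_mul,
    show p + 2 - 1 = p + 1 from rfl]
  ring

end DSingularity

/-! ### Elements of `G(m,p,2)` and their action on polynomials -/

lemma imprimitiveGroup_two_cases {m p : ℕ} {g : GL (Fin 2) ℂ} (hg : g ∈ imprimitiveGroup m p 2) :
    ∃ u v : ℂ, u ^ m = 1 ∧ v ^ m = 1 ∧ (u * v) ^ (m / p) = 1 ∧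
      ((g : Matrix (Fin 2) (Fin 2) ℂ) = !![u, 0; 0, v] ∨
        (g : Matrix (Fin 2) (Fin 2) ℂ) = !![0, v; u, 0]) := by
  obtain ⟨s, d, hd, hD, hg⟩ := hg
  have key : ∀ s : Equiv.Perm (Fin 2), s = 1 ∨ s = Equiv.swap 0 1 := by decide
  rw [Fin.prod_univ_two] at hD
  refine ⟨d 0, d 1, by rw [← Units.val_pow_eq_pow_val, hd, Units.val_one],
    by rw [← Units.val_pow_eq_pow_val, hd, Units.val_one],
    by rw [← Units.val_mul, ← Units.val_pow_eq_pow_val, hD, Units.val_one], ?_⟩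
  rcases key s with rfl | rfl
  · left
    ext i j
    rw [hg]
    fin_cases i <;> fin_cases j <;> simp
  · right
    ext i j
    rw [hg]
    fin_cases i <;> fin_cases j <;> simp

lemma exists_diag_mem {m p : ℕ} (hm : 0 < m) {u v : ℂ} (hu : u ^ m = 1) (hv : v ^ m = 1)
    (huv : (u * v) ^ (m / p) = 1) :
    ∃ g : imprimitiveGroup m p 2,
      ((g : GL (Fin 2) ℂ) : Matrix (Fin 2) (Fin 2) ℂ) = !![u, 0; 0, v] := by
  have hu0 : u ≠ 0 := by rintro rfl; simp [hm.ne'] at hu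
  have hv0 : v ≠ 0 := by rintro rfl; simp [hm.ne'] at hv
  refine ⟨⟨Matrix.GeneralLinearGroup.mkOfDetNeZero !![u, 0; 0, v] (by simp [hu0, hv0]),
    1, ![Units.mk0 u hu0, Units.mk0 v hv0], ?_, ?_, ?_⟩, rfl⟩
  · intro j
    ext
    fin_cases j <;> simpa
  · ext
    simpa using huv
  · intro i j
    fin_cases i <;> fin_cases j <;> simp [Matrix.GeneralLinearGroup.mkOfDetNeZero]

lemma exists_antidiag_mem {m p : ℕ} (hm : 0 < m) {u v : ℂ} (hu : u ^ m = 1) (hv : v ^ m = 1)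
    (huv : (u * v) ^ (m / p) = 1) :
    ∃ g : imprimitiveGroup m p 2,
      ((g : GL (Fin 2) ℂ) : Matrix (Fin 2) (Fin 2) ℂ) = !![0, v; u, 0] := by
  have hu0 : u ≠ 0 := by rintro rfl; simp [hm.ne'] at hu
  have hv0 : v ≠ 0 := by rintro rfl; simp [hm.ne'] at hv
  refine ⟨⟨Matrix.GeneralLinearGroup.mkOfDetNeZero !![0, v; u, 0] (by simp [hu0, hv0]),
    Equiv.swap 0 1, ![Units.mk0 u hu0, Units.mk0 v hv0], ?_, ?_, ?_⟩, rfl⟩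
  · intro j
    ext
    fin_cases j <;> simpa
  · ext
    simpa using huv
  · intro i j
    fin_cases i <;> fin_cases j <;> simp [Matrix.GeneralLinearGroup.mkOfDetNeZero]

/-- The substitution `x ↦ u x`, `y ↦ v y`. -/
noncomputable def scaleVars (u v : ℂ) : MvPolynomial (Fin 2) ℂ →ₐ[ℂ] MvPolynomial (Fin 2) ℂ :=
  aeval ![C u * X 0, C v * X 1]

/-- The substitution that exchanges the two variables. -/
noncomputable def swapVars : MvPolynomial (Fin 2) ℂ →ₐ[ℂ] MvPolynomial (Fin 2) ℂ :=
  rename (Equiv.swap 0 1)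

@[simp] lemma swapVars_X_zero : swapVars (X 0) = X 1 := by simp [swapVars]

@[simp] lemma swapVars_X_one : swapVars (X 1) = X 0 := by simp [swapVars]

@[simp] lemma swapVars_C (a : ℂ) : swapVars (C a) = C a := by simp [swapVars]

@[simp] lemma swapVars_swapVars (f : MvPolynomial (Fin 2) ℂ) : swapVars (swapVars f) = f := by
  have : (Equiv.swap (0 : Fin 2) 1 : Fin 2 → Fin 2) ∘ (Equiv.swap 0 1) = id := by
    ext i; fin_cases i <;> rfl
  rw [swapVars, rename_rename, this, rename_id_apply]

@[simp] lemma scaleVars_X_zero (u v : ℂ) : scaleVars u v (X 0) = C u * X 0 := by simp [scaleVars]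

@[simp] lemma scaleVars_X_one (u v : ℂ) : scaleVars u v (X 1) = C v * X 1 := by simp [scaleVars]

@[simp] lemma scaleVars_C (u v a : ℂ) : scaleVars u v (C a) = C a := by
  simp [scaleVars, algebraMap_eq]

lemma scaleVars_swapVars (u v : ℂ) (f : MvPolynomial (Fin 2) ℂ) :
    scaleVars u v (swapVars f) = swapVars (scaleVars v u f) := by
  have : (scaleVars u v).comp swapVars = swapVars.comp (scaleVars v u) := by
    refine algHom_ext fun i => ?_
    fin_cases i <;> simp
  exact DFunLike.congr_fun this f

lemma symRep_of_diag {G : Subgroup (GL (Fin 2) ℂ)} {g : G} {u v : ℂ}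
    (hg : ((g : GL (Fin 2) ℂ) : Matrix (Fin 2) (Fin 2) ℂ) = !![u, 0; 0, v])
    (f : MvPolynomial (Fin 2) ℂ) : symRep G g f = scaleVars u v f := by
  have : linSubst (g : GL (Fin 2) ℂ) = scaleVars u v := by
    refine algHom_ext fun i => ?_
    fin_cases i <;> simp [linSubst, hg, Fin.sum_univ_two]
  exact DFunLike.congr_fun this f

lemma symRep_of_antidiag {G : Subgroup (GL (Fin 2) ℂ)} {g : G} {u v : ℂ}
    (hg : ((g : GL (Fin 2) ℂ) : Matrix (Fin 2) (Fin 2) ℂ) = !![0, v; u, 0])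
    (f : MvPolynomial (Fin 2) ℂ) : symRep G g f = swapVars (scaleVars u v f) := by
  have : linSubst (g : GL (Fin 2) ℂ) = swapVars.comp (scaleVars u v) := by
    refine algHom_ext fun i => ?_
    fin_cases i <;> simp [linSubst, hg, Fin.sum_univ_two]
  exact DFunLike.congr_fun this f

lemma monomial_fin_two (d : Fin 2 →₀ ℕ) (a : ℂ) :
    (monomial d a : MvPolynomial (Fin 2) ℂ) = C a * (X 0 ^ d 0 * X 1 ^ d 1) := by
  rw [monomial_eq, Finsupp.prod_fintype _ _ (by simp), Fin.prod_univ_two]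

lemma coeff_scaleVars (u v : ℂ) (f : MvPolynomial (Fin 2) ℂ) (d : Fin 2 →₀ ℕ) :
    coeff d (scaleVars u v f) = u ^ d 0 * v ^ d 1 * coeff d f := by
  induction f using MvPolynomial.induction_on' with
  | monomial e a =>
    have : scaleVars u v (monomial e a) = C (u ^ e 0 * v ^ e 1) * monomial e a := by
      simp only [monomial_fin_two, map_mul, map_pow, scaleVars_C, scaleVars_X_zero,
        scaleVars_X_one]
      ring
    rw [this, coeff_C_mul, coeff_monomial]
    split_ifs with h
    · rw [h]
    · simp
  | add f g hf hg => rw [map_add, coeff_add, coeff_add, hf, hg, mul_add]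

/-! ### Weights -/

/-- The grading of `ℂ[x, y]` by the characters of the diagonal subgroup of `G(m,p,2)`, where
`q = m / p`: the monomial `x^k y^l` has degree `(k, k - l)`. -/
def wt (q m : ℕ) : Fin 2 → ZMod q × ZMod m := ![(1, 1), (0, -1)]

/-- The degree of `x^a y^b` for the grading `wt`. -/
def wtDeg (q m a b : ℕ) : ZMod q × ZMod m := (a, a - b)

lemma weight_wt (q m : ℕ) (d : Fin 2 →₀ ℕ) :
    Finsupp.weight (wt q m) d = wtDeg q m (d 0) (d 1) := by
  rw [Finsupp.weight_apply, Finsupp.sum_fintype _ _ (by simp), Fin.sum_univ_two]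
  simp [wt, wtDeg, sub_eq_add_neg]

lemma wtDeg_add (q m a b c d : ℕ) :
    wtDeg q m (a + c) (b + d) = wtDeg q m a b + wtDeg q m c d := by
  simp only [wtDeg, Prod.mk_add_mk, Prod.mk.injEq]
  push_cast
  exact ⟨rfl, by ring⟩

lemma wtDeg_zero (q m : ℕ) : wtDeg q m 0 0 = 0 := by simp [wtDeg]

section Weights

variable {m p q : ℕ}

lemma wtDeg_eq_iff {a b c d : ℕ} :
    wtDeg q m a b = wtDeg q m c d ↔ (q : ℤ) ∣ a - c ∧ (m : ℤ) ∣ (a - b) - (c - d) := by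
  have h1 : ((a : ZMod q) = c) ↔ (q : ℤ) ∣ a - c := by
    rw [← ZMod.intCast_zmod_eq_zero_iff_dvd]
    push_cast
    exact sub_eq_zero.symm
  have h2 : ((a : ZMod m) - b = c - d) ↔ (m : ℤ) ∣ (a - b) - (c - d) := by
    rw [← ZMod.intCast_zmod_eq_zero_iff_dvd]
    push_cast
    exact sub_eq_zero.symm
  rw [wtDeg, wtDeg, Prod.mk.injEq, h1, h2]

lemma pow_mul_pow_eq_of_wtDeg_eq (hm : 0 < m) (hqm : q ∣ m) {a b c d : ℕ}
    (h : wtDeg q m a b = wtDeg q m c d) {u v : ℂ} (hu : u ^ m = 1) (huv : (u * v) ^ q = 1) :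
    u ^ a * v ^ b = u ^ c * v ^ d := by
  obtain ⟨h1, h2⟩ := wtDeg_eq_iff.1 h
  have hu0 : u ≠ 0 := by rintro rfl; simp [hm.ne'] at hu
  have hq0 : q ≠ 0 := by rintro rfl; exact hm.ne' (zero_dvd_iff.1 hqm)
  have huv0 : u * v ≠ 0 := by intro h; rw [h] at huv; simp [hq0] at huv
  have h3 : (q : ℤ) ∣ b - d := by
    have : (b : ℤ) - d = (a - c) - ((a - b) - (c - d)) := by ring
    rw [this]
    exact dvd_sub h1 ((Int.natCast_dvd_natCast.2 hqm).trans h2)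
  have key : ∀ a b : ℕ, u ^ a * v ^ b = u ^ ((a : ℤ) - b) * (u * v) ^ (b : ℤ) := fun a b => by
    rw [zpow_sub₀ hu0, mul_zpow, zpow_natCast, zpow_natCast, zpow_natCast]
    field_simp
  have e1 : ∀ (x : ℂ) (n : ℕ) (k l : ℤ), x ≠ 0 → x ^ n = 1 → (n : ℤ) ∣ k - l → x ^ k = x ^ l := by
    rintro x n k l hx hxn ⟨e, he⟩
    rw [show k = l + n * e by linarith, zpow_add₀ hx, zpow_mul, zpow_natCast, hxn, one_zpow,
      mul_one]
  rw [key, key, e1 u m _ _ hu0 hu h2, e1 (u * v) q _ _ huv0 huv h3]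

lemma wtDeg_eq_of_pow_mul_pow_eq (hm : 0 < m) (hmpq : m = p * q) {a b c d : ℕ}
    (h : ∀ u v : ℂ, u ^ m = 1 → v ^ m = 1 → (u * v) ^ q = 1 → u ^ a * v ^ b = u ^ c * v ^ d) :
    wtDeg q m a b = wtDeg q m c d := by
  have hζ := Complex.isPrimitiveRoot_exp m hm.ne'
  set ζ := Complex.exp (2 * Real.pi * Complex.I / m)
  have hζ0 : ζ ≠ 0 := hζ.ne_zero hm.ne'
  have hp0 : p ≠ 0 := by rintro rfl; simp at hmpq; omega
  rw [wtDeg_eq_iff]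
  have e1 : ∀ k l : ℤ, ζ ^ k = ζ ^ l → (m : ℤ) ∣ k - l := fun k l hkl => by
    rw [← hζ.zpow_eq_one_iff_dvd, zpow_sub₀ hζ0, hkl, div_self (zpow_ne_zero _ hζ0)]
  constructor
  · have := h (ζ ^ p) 1 (by rw [← pow_mul, mul_comm, pow_mul, hζ.pow_eq_one, one_pow]) (by simp)
      (by rw [mul_one, ← pow_mul, ← hmpq, hζ.pow_eq_one])
    rw [one_pow, one_pow, mul_one, mul_one, ← pow_mul, ← pow_mul] at this
    have h2 := e1 (p * a : ℕ) (p * c : ℕ) (by rw [zpow_natCast, zpow_natCast, this])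
    rw [hmpq] at h2
    push_cast at h2
    rw [← mul_sub] at h2
    exact (mul_dvd_mul_iff_left (by exact_mod_cast hp0)).1 h2
  · have := h ζ ζ⁻¹ hζ.pow_eq_one (by rw [inv_pow, hζ.pow_eq_one, inv_one])
      (by rw [mul_inv_cancel₀ hζ0, one_pow])
    refine e1 _ _ ?_
    rw [zpow_sub₀ hζ0, zpow_sub₀ hζ0]
    simpa [div_eq_mul_inv] using this

lemma scaleVars_of_isWeightedHomogeneous (hm : 0 < m) (hqm : q ∣ m) {a b : ℕ}
    {f : MvPolynomial (Fin 2) ℂ} (hf : IsWeightedHomogeneous (wt q m) f (wtDeg q m a b))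
    {u v : ℂ} (hu : u ^ m = 1) (huv : (u * v) ^ q = 1) :
    scaleVars u v f = C (u ^ a * v ^ b) * f := by
  ext d
  rw [coeff_scaleVars, coeff_C_mul]
  by_cases hd : coeff d f = 0
  · rw [hd, mul_zero, mul_zero]
  · have := hf hd
    rw [weight_wt] at this
    rw [pow_mul_pow_eq_of_wtDeg_eq hm hqm this hu huv]

lemma isWeightedHomogeneous_of_scaleVars (hm : 0 < m) (hmpq : m = p * q) {a b : ℕ}
    {f : MvPolynomial (Fin 2) ℂ}
    (hf : ∀ u v : ℂ, u ^ m = 1 → v ^ m = 1 → (u * v) ^ q = 1 →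
      scaleVars u v f = C (u ^ a * v ^ b) * f) :
    IsWeightedHomogeneous (wt q m) f (wtDeg q m a b) := by
  intro d hd
  rw [weight_wt]
  refine wtDeg_eq_of_pow_mul_pow_eq hm hmpq fun u v hu hv huv => ?_
  have := congrArg (coeff d) (hf u v hu hv huv)
  rw [coeff_scaleVars, coeff_C_mul] at this
  exact mul_right_cancel₀ hd this

lemma isWeightedHomogeneous_swapVars (hm : 0 < m) (hmpq : m = p * q) {a b : ℕ}
    {f : MvPolynomial (Fin 2) ℂ} (hf : IsWeightedHomogeneous (wt q m) f (wtDeg q m a b)) :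
    IsWeightedHomogeneous (wt q m) (swapVars f) (wtDeg q m b a) := by
  refine isWeightedHomogeneous_of_scaleVars hm hmpq fun u v hu hv huv => ?_
  rw [scaleVars_swapVars, scaleVars_of_isWeightedHomogeneous hm (Dvd.intro_left p hmpq.symm) hf hv
    (by rwa [mul_comm]), map_mul, swapVars_C, mul_comm (v ^ a)]

lemma isWeightedHomogeneous_X_pow_mul_X_pow (a b : ℕ) :
    IsWeightedHomogeneous (wt q m) (X 0 ^ a * X 1 ^ b : MvPolynomial (Fin 2) ℂ)
      (wtDeg q m a b) := by
  have := ((isWeightedHomogeneous_X ℂ (wt q m) 0).pow a).mul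
    ((isWeightedHomogeneous_X ℂ (wt q m) 1).pow b)
  convert this using 1
  simp [wt, wtDeg, sub_eq_add_neg]

end Weights

/-! ### Spanning sets of the weight spaces -/

section Spanning

variable {m p q : ℕ}

lemma mem_span_of_isWeightedHomogeneous (hmpq : m = p * q)
    {A : Subalgebra ℂ (MvPolynomial (Fin 2) ℂ)} (hs : (X 0 * X 1) ^ q ∈ A)
    (ht : X 0 ^ m + X 1 ^ m ∈ A) {c e j : ℕ} (hc : c < q) (he : e < q) (hj : j ≤ p)
    {f : MvPolynomial (Fin 2) ℂ}
    (hf : IsWeightedHomogeneous (wt q m) f (wtDeg q m c (j * q + e))) :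
    f ∈ Submodule.span A {X 0 ^ c * X 1 ^ e * X 0 ^ ((p - j) * q),
      X 0 ^ c * X 1 ^ e * X 1 ^ (j * q)} := by
  set v₀ : MvPolynomial (Fin 2) ℂ := X 0 ^ c * X 1 ^ e * X 0 ^ ((p - j) * q) with hv₀
  set v₁ : MvPolynomial (Fin 2) ℂ := X 0 ^ c * X 1 ^ e * X 1 ^ (j * q) with hv₁
  set N := Submodule.span A {v₀, v₁} with hN
  have h₀ : v₀ ∈ N := Submodule.subset_span (by simp)
  have h₁ : v₁ ∈ N := Submodule.subset_span (by simp)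
  have hA : ∀ a ∈ A, ∀ x ∈ N, a * x ∈ N := fun a ha x hx => N.smul_mem ⟨a, ha⟩ hx
  obtain ⟨l, rfl⟩ : ∃ l, p = j + l := ⟨p - j, by omega⟩
  rw [show j + l - j = l by omega] at hv₀
  have hsj : ∀ i : ℕ, (X 0 * X 1 : MvPolynomial (Fin 2) ℂ) ^ (q * i) ∈ A := fun i => by
    rw [pow_mul]; exact A.pow_mem hs i
  have hU : ∀ x ∈ N, X 1 ^ m * x ∈ N := fun x hx => by
    induction hx using Submodule.span_induction with
    | mem x hx =>
      rcases hx with rfl | rfl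
      · have : X 1 ^ m * v₀ = (X 0 * X 1) ^ (q * l) * v₁ := by
          rw [hv₀, hv₁, hmpq]; ring
        rw [this]
        exact hA _ (hsj _) _ h₁
      · have : X 1 ^ m * v₁ = (X 0 ^ m + X 1 ^ m) * v₁ - (X 0 * X 1) ^ (q * j) * v₀ := by
          rw [hv₀, hv₁, hmpq]; ring
        rw [this]
        exact N.sub_mem (hA _ ht _ h₁) (hA _ (hsj _) _ h₀)
    | zero => simp
    | add x y _ _ hx hy => rw [mul_add]; exact N.add_mem hx hy
    | smul a x _ hx => rw [mul_smul_comm]; exact N.smul_mem a hx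
  have hT : ∀ x ∈ N, X 0 ^ m * x ∈ N := fun x hx => by
    have : X 0 ^ m * x = (X 0 ^ m + X 1 ^ m) * x - X 1 ^ m * x := by ring
    rw [this]
    exact N.sub_mem (hA _ ht _ hx) (hU x hx)
  have hUn : ∀ n : ℕ, X 1 ^ (m * n) * v₁ ∈ N := fun n => by
    induction n with
    | zero => simpa using h₁
    | succ n ih =>
      rw [mul_add, mul_one, pow_add, mul_comm (X 1 ^ (m * n)), mul_assoc]
      exact hU _ ih
  have hTn : ∀ n : ℕ, X 0 ^ (m * n) * v₀ ∈ N := fun n => by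
    induction n with
    | zero => simpa using h₀
    | succ n ih =>
      rw [mul_add, mul_one, pow_add, mul_comm (X 0 ^ (m * n)), mul_assoc]
      exact hT _ ih
  rw [f.as_sum]
  refine N.sum_mem fun d hd => ?_
  have hw := hf (mem_support_iff.1 hd)
  rw [weight_wt, wtDeg_eq_iff] at hw
  obtain ⟨hw1, hw2⟩ := hw
  rw [monomial_fin_two]
  refine hA _ (A.algebraMap_mem _) _ ?_
  have hq0 : 0 < q := by omega
  obtain ⟨k, hk⟩ : ∃ k : ℕ, d 0 = c + q * k := by
    refine ⟨d 0 / q, ?_⟩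
    have : d 0 % q = c := by
      have := (Nat.modEq_iff_dvd.2 hw1 : c ≡ d 0 [MOD q])
      rw [← this, Nat.mod_eq_of_lt hc]
    rw [← this, Nat.mod_add_div]
  obtain ⟨i, hi⟩ : ∃ i : ℕ, d 1 = e + q * i := by
    refine ⟨d 1 / q, ?_⟩
    have : d 1 % q = e := by
      have h3 : (q : ℤ) ∣ (d 1 : ℤ) - e := by
        have h4 : (q : ℤ) ∣ (m : ℤ) := ⟨(j + l : ℕ), by rw [hmpq]; push_cast; ring⟩
        have : (d 1 : ℤ) - e =
            (d 0 - c) - ((d 0 - d 1) - (c - (j * q + e : ℕ))) + q * j := by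
          push_cast; ring
        rw [this]
        exact dvd_add (dvd_sub hw1 (h4.trans hw2)) (dvd_mul_right _ _)
      have := (Nat.modEq_iff_dvd.2 h3 : e ≡ d 1 [MOD q])
      rw [← this, Nat.mod_eq_of_lt he]
    rw [← this, Nat.mod_add_div]
  obtain ⟨n, hn⟩ := hw2
  have hn' : (k : ℤ) - i + j = (j + l) * n := by
    have hq' : (q : ℤ) ≠ 0 := by exact_mod_cast hq0.ne'
    refine mul_left_cancel₀ hq' ?_
    rw [hk, hi, hmpq] at hn
    push_cast at hn
    linarith
  rw [hk, hi]
  rcases le_or_gt n 0 with hn0 | hn0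
  · obtain ⟨n, rfl⟩ : ∃ n' : ℕ, n = -n' := ⟨n.natAbs, by omega⟩
    have hi' : i = k + j + (j + l) * n := by
      zify
      linarith
    have : (X 0 ^ (c + q * k) * X 1 ^ (e + q * i) : MvPolynomial (Fin 2) ℂ) =
        (X 0 * X 1) ^ (q * k) * (X 1 ^ (m * n) * v₁) := by
      rw [hv₁, hi', hmpq]; ring
    rw [this]
    exact hA _ (hsj _) _ (hUn n)
  · obtain ⟨n, rfl⟩ : ∃ n' : ℕ, n = n' + 1 := ⟨n.toNat - 1, by omega⟩
    have hk' : k = i + l + (j + l) * n := by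
      zify
      linarith
    have : (X 0 ^ (c + q * k) * X 1 ^ (e + q * i) : MvPolynomial (Fin 2) ℂ) =
        (X 0 * X 1) ^ (q * i) * (X 0 ^ (m * n) * v₀) := by
      rw [hv₀, hk', hmpq]; ring
    rw [this]
    exact hA _ (hsj _) _ (hTn n)

end Spanning

/-! ### The basic invariants -/

section Invariants

variable {m p q : ℕ}

lemma InvRing.incl_injective {n : ℕ} (G : Subgroup (GL (Fin n) ℂ)) :
    Function.Injective (InvRing.incl G) := Subtype.val_injective

lemma mem_invariantSubalgebra_iff (hm : 0 < m) (hmpq : m = p * q) {f : MvPolynomial (Fin 2) ℂ} :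
    f ∈ invariantSubalgebra (imprimitiveGroup m p 2) ↔
      IsWeightedHomogeneous (wt q m) f 0 ∧ swapVars f = f := by
  have hp0 : 0 < p := Nat.pos_of_ne_zero (by rintro rfl; simp at hmpq; omega)
  have hq : m / p = q := by rw [hmpq, Nat.mul_div_cancel_left _ hp0]
  constructor
  · intro hf
    constructor
    · rw [← wtDeg_zero q m]
      refine isWeightedHomogeneous_of_scaleVars hm hmpq fun u v hu hv huv => ?_
      obtain ⟨g, hg⟩ := exists_diag_mem (p := p) hm hu hv (by rwa [hq])
      rw [← symRep_of_diag hg, hf g]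
      simp
    · obtain ⟨g, hg⟩ := exists_antidiag_mem (m := m) (p := p) hm (u := 1) (v := 1) (by simp)
        (by simp) (by simp)
      have := hf g
      rw [symRep_of_antidiag hg] at this
      have h1 : scaleVars 1 1 = AlgHom.id ℂ _ := algHom_ext fun i => by fin_cases i <;> simp
      rwa [h1] at this
  · rintro ⟨hf, hswap⟩ g
    obtain ⟨u, v, hu, hv, huv, hg | hg⟩ := imprimitiveGroup_two_cases g.2
    all_goals
      rw [← wtDeg_zero q m] at hf
      rw [hq] at huv
      have := scaleVars_of_isWeightedHomogeneous hm (Dvd.intro_left p hmpq.symm) hf hu huv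
    · rw [symRep_of_diag hg, this]
      simp
    · rw [symRep_of_antidiag hg, this]
      simp [hswap]

lemma incl_isWeightedHomogeneous (hm : 0 < m) (hmpq : m = p * q)
    (r : InvRing (imprimitiveGroup m p 2)) :
    IsWeightedHomogeneous (wt q m) (InvRing.incl _ r) 0 :=
  ((mem_invariantSubalgebra_iff hm hmpq).1 r.2).1

lemma swapVars_incl (hm : 0 < m) (hmpq : m = p * q) (r : InvRing (imprimitiveGroup m p 2)) :
    swapVars (InvRing.incl _ r) = InvRing.incl _ r :=
  ((mem_invariantSubalgebra_iff hm hmpq).1 r.2).2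

lemma sigma_one_mem (hm : 0 < m) (hmpq : m = p * q) :
    (X 0 * X 1) ^ q ∈ invariantSubalgebra (imprimitiveGroup m p 2) := by
  rw [mem_invariantSubalgebra_iff hm hmpq]
  constructor
  · have := isWeightedHomogeneous_X_pow_mul_X_pow (q := q) (m := m) q q
    rw [← mul_pow] at this
    rwa [show wtDeg q m q q = 0 by simp [wtDeg]] at this
  · simp [mul_comm]

lemma isWeightedHomogeneous_X_pow (hmpq : m = p * q) (l : Fin 2) :
    IsWeightedHomogeneous (wt q m) (X l ^ m : MvPolynomial (Fin 2) ℂ) 0 := by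
  have hmq : (m : ZMod q) = 0 := (ZMod.natCast_eq_zero_iff _ _).2 (Dvd.intro_left p hmpq.symm)
  have h := (isWeightedHomogeneous_X ℂ (wt q m) l).pow m
  rwa [show m • wt q m l = 0 by fin_cases l <;> simp [wt, hmq]] at h

lemma sigma_two_mem (hm : 0 < m) (hmpq : m = p * q) :
    X 0 ^ m + X 1 ^ m ∈ invariantSubalgebra (imprimitiveGroup m p 2) := by
  rw [mem_invariantSubalgebra_iff hm hmpq]
  constructor
  · exact (isWeightedHomogeneous_X_pow hmpq 0).add (isWeightedHomogeneous_X_pow hmpq 1)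
  · simp [add_comm]

lemma X_pow_sub_X_pow_ne_zero (hm : 0 < m) :
    (X 0 ^ m - X 1 ^ m : MvPolynomial (Fin 2) ℂ) ≠ 0 := fun h => by
  have := congrArg (eval ![1, 0]) h
  simp [hm.ne'] at this

lemma adjoin_eq_invariantSubalgebra (hm : 0 < m) (hmpq : m = p * q) :
    Algebra.adjoin ℂ {(X 0 * X 1) ^ q, X 0 ^ m + X 1 ^ m} =
      invariantSubalgebra (imprimitiveGroup m p 2) := by
  have hq0 : 0 < q := Nat.pos_of_ne_zero (by rintro rfl; omega)
  set A := Algebra.adjoin ℂ {(X 0 * X 1 : MvPolynomial (Fin 2) ℂ) ^ q, X 0 ^ m + X 1 ^ m} with hA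
  have hle : A ≤ invariantSubalgebra (imprimitiveGroup m p 2) := by
    rw [hA, Algebra.adjoin_le_iff]
    rintro x (rfl | rfl)
    · exact sigma_one_mem hm hmpq
    · exact sigma_two_mem hm hmpq
  refine le_antisymm hle fun f hf => ?_
  rw [mem_invariantSubalgebra_iff hm hmpq, ← wtDeg_zero q m] at hf
  obtain ⟨hf, hswap⟩ := hf
  have := mem_span_of_isWeightedHomogeneous hmpq (A := A)
    (Algebra.subset_adjoin (by simp)) (Algebra.subset_adjoin (by simp)) (c := 0) (e := 0) (j := 0)
    hq0 hq0 (Nat.zero_le p) (f := f) (by simpa using hf)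
  rw [Submodule.mem_span_pair] at this
  obtain ⟨a, b, hab⟩ := this
  simp only [Subalgebra.smul_def, smul_eq_mul, pow_zero, mul_one, one_mul, Nat.sub_zero, zero_mul,
    ← hmpq] at hab
  have ha := ((mem_invariantSubalgebra_iff hm hmpq).1 (hle a.2)).2
  have hb := ((mem_invariantSubalgebra_iff hm hmpq).1 (hle b.2)).2
  have h1 : (a : MvPolynomial (Fin 2) ℂ) * X 1 ^ m + (b : MvPolynomial (Fin 2) ℂ) = f := by
    have := congrArg swapVars hab
    simpa [ha, hb, hswap] using this
  have h2 : (a : MvPolynomial (Fin 2) ℂ) * (X 0 ^ m - X 1 ^ m) = 0 := by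
    linear_combination hab - h1
  have h3 : (a : MvPolynomial (Fin 2) ℂ) = 0 :=
    (mul_eq_zero.1 h2).resolve_right (X_pow_sub_X_pow_ne_zero hm)
  rw [h3, zero_mul, zero_add] at hab
  rw [← hab]
  exact b.2

lemma exists_eval_basicInvariants (hm : 0 < m) (hmpq : m = p * q) (s t : ℂ) :
    ∃ x y : ℂ, (x * y) ^ q = s ∧ x ^ m + y ^ m = t := by
  have hq0 : 0 < q := Nat.pos_of_ne_zero (by rintro rfl; omega)
  rcases eq_or_ne s 0 with rfl | hs
  · obtain ⟨y, hy⟩ := IsAlgClosed.exists_pow_nat_eq t hm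
    exact ⟨0, y, by simp [hq0.ne'], by simp [hm.ne', hy]⟩
  · obtain ⟨d, hd⟩ := IsAlgClosed.exists_pow_nat_eq (t ^ 2 - 4 * s ^ p) two_pos
    have hw : ((t + d) / 2) ^ 2 - t * ((t + d) / 2) + s ^ p = 0 := by
      linear_combination hd / 4
    set w := (t + d) / 2
    have hw0 : w ≠ 0 := fun h => by
      rw [h] at hw
      simp [hs] at hw
    obtain ⟨x, hx⟩ := IsAlgClosed.exists_pow_nat_eq w hm
    obtain ⟨u, hu⟩ := IsAlgClosed.exists_pow_nat_eq s hq0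
    have hx0 : x ≠ 0 := by
      rintro rfl
      exact hw0 (by rw [← hx, zero_pow hm.ne'])
    refine ⟨x, u / x, by rw [mul_div_cancel₀ _ hx0, hu], ?_⟩
    have hum : u ^ m = s ^ p := by rw [hmpq, mul_comm, pow_mul, hu]
    rw [div_pow, hx, hum]
    field_simp
    linear_combination hw

lemma algebraicIndependent_basicInvariants (hm : 0 < m) (hmpq : m = p * q) :
    AlgebraicIndependent ℂ
      ![(X 0 * X 1 : MvPolynomial (Fin 2) ℂ) ^ q, X 0 ^ m + X 1 ^ m] := by
  rw [algebraicIndependent_iff]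
  intro P hP
  refine MvPolynomial.funext fun v => ?_
  obtain ⟨x, y, hs, ht⟩ := exists_eval_basicInvariants hm hmpq (v 0) (v 1)
  have h1 : ((aeval ![x, y]).comp
      (aeval ![(X 0 * X 1 : MvPolynomial (Fin 2) ℂ) ^ q, X 0 ^ m + X 1 ^ m]) :
        MvPolynomial (Fin 2) ℂ →ₐ[ℂ] ℂ) = aeval v := by
    refine algHom_ext fun i => ?_
    fin_cases i
    · simpa using hs
    · simpa using ht
  have := DFunLike.congr_fun h1 P
  rw [AlgHom.comp_apply, hP, map_zero] at this
  rw [map_zero, this, aeval_eq_eval]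

lemma adjoin_eq_top (hm : 0 < m) (hmpq : m = p * q) {σ₁ σ₂ : InvRing (imprimitiveGroup m p 2)}
    (h₁ : InvRing.incl _ σ₁ = (X 0 * X 1) ^ q) (h₂ : InvRing.incl _ σ₂ = X 0 ^ m + X 1 ^ m) :
    Algebra.adjoin ℂ {σ₁, σ₂} = ⊤ := by
  refine Algebra.eq_top_iff.2 fun r => ?_
  have hr : InvRing.incl _ r ∈ (Algebra.adjoin ℂ {σ₁, σ₂}).map (InvRing.incl _) := by
    rw [AlgHom.map_adjoin, Set.image_pair, h₁, h₂, adjoin_eq_invariantSubalgebra hm hmpq]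
    exact r.2
  obtain ⟨r', hr', h⟩ := hr
  rwa [← InvRing.incl_injective _ h]

lemma algebraicIndependent_sigma (hm : 0 < m) (hmpq : m = p * q)
    {σ₁ σ₂ : InvRing (imprimitiveGroup m p 2)}
    (h₁ : InvRing.incl _ σ₁ = (X 0 * X 1) ^ q) (h₂ : InvRing.incl _ σ₂ = X 0 ^ m + X 1 ^ m) :
    AlgebraicIndependent ℂ ![σ₁, σ₂] := by
  refine AlgebraicIndependent.of_comp (InvRing.incl _) ?_
  convert algebraicIndependent_basicInvariants hm hmpq using 1
  ext1 i
  fin_cases i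
  · exact h₁
  · exact h₂

lemma nonempty_mvPolynomial_equiv_invRing (hm : 0 < m) (hmpq : m = p * q) :
    Nonempty (MvPolynomial (Fin 2) ℂ ≃ₐ[ℂ] InvRing (imprimitiveGroup m p 2)) := by
  obtain ⟨σ₁, h₁⟩ : ∃ σ, InvRing.incl (imprimitiveGroup m p 2) σ = (X 0 * X 1) ^ q :=
    ⟨⟨_, sigma_one_mem hm hmpq⟩, rfl⟩
  obtain ⟨σ₂, h₂⟩ : ∃ σ, InvRing.incl (imprimitiveGroup m p 2) σ = X 0 ^ m + X 1 ^ m :=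
    ⟨⟨_, sigma_two_mem hm hmpq⟩, rfl⟩
  have h := algebraicIndependent_sigma hm hmpq h₁ h₂
  have htop := adjoin_eq_top hm hmpq h₁ h₂
  rw [← Matrix.range_cons_cons_empty _ _ ![]] at htop
  exact ⟨(h.aevalEquiv.trans (Subalgebra.equivOfEq _ _ htop)).trans Subalgebra.topEquiv⟩

lemma isDomain_invRing {n : ℕ} (G : Subgroup (GL (Fin n) ℂ)) : IsDomain (InvRing G) :=
  inferInstanceAs (IsDomain (invariantSubalgebra G))

lemma isNoetherianRing_invRing (hm : 0 < m) (hmpq : m = p * q) :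
    IsNoetherianRing (InvRing (imprimitiveGroup m p 2)) := by
  obtain ⟨e⟩ := nonempty_mvPolynomial_equiv_invRing hm hmpq
  exact isNoetherianRing_of_ringEquiv _ e.toRingEquiv

lemma uniqueFactorizationMonoid_invRing (hm : 0 < m) (hmpq : m = p * q) :
    UniqueFactorizationMonoid (InvRing (imprimitiveGroup m p 2)) := by
  obtain ⟨e⟩ := nonempty_mvPolynomial_equiv_invRing hm hmpq
  exact e.toRingEquiv.toMulEquiv.uniqueFactorizationMonoid inferInstance

lemma ringKrullDim_invRing (hm : 0 < m) (hmpq : m = p * q) :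
    ringKrullDim (InvRing (imprimitiveGroup m p 2)) = 2 := by
  obtain ⟨e⟩ := nonempty_mvPolynomial_equiv_invRing hm hmpq
  rw [← ringKrullDim_eq_of_ringEquiv e.toRingEquiv, MvPolynomial.ringKrullDim_of_isNoetherianRing,
    ringKrullDim_eq_zero_of_field]
  simp

end Invariants

/-! ### The reflection arrangement of `G(m,p,2)` -/

/-- The line `c x + d y = 0` in the plane. -/
noncomputable def planeLine (c d : ℂ) : Submodule ℂ (Fin 2 → ℂ) :=
  LinearMap.ker (c • LinearMap.proj 0 + d • LinearMap.proj 1 : (Fin 2 → ℂ) →ₗ[ℂ] ℂ)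

lemma mem_planeLine {c d : ℂ} {v : Fin 2 → ℂ} : v ∈ planeLine c d ↔ c * v 0 + d * v 1 = 0 := by
  simp [planeLine]

lemma finrank_planeLine {c d : ℂ} (h : c ≠ 0 ∨ d ≠ 0) :
    Module.finrank ℂ (planeLine c d) + 1 = 2 := by
  have : (c • LinearMap.proj 0 + d • LinearMap.proj 1 : (Fin 2 → ℂ) →ₗ[ℂ] ℂ) ≠ 0 := fun h0 => by
    have h1 := LinearMap.congr_fun h0 ![1, 0]
    have h2 := LinearMap.congr_fun h0 ![0, 1]
    simp at h1 h2
    tauto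
  rw [planeLine, Module.Dual.finrank_ker_add_one_of_ne_zero this]
  simp

lemma exists_eq_C_mul_of_isDefiningForm {c d : ℂ} (h : c ≠ 0 ∨ d ≠ 0)
    {f : MvPolynomial (Fin 2) ℂ} (hf : IsDefiningForm (planeLine c d) f) :
    ∃ k : ℂ, k ≠ 0 ∧ f = C k * (C c * X 0 + C d * X 1) := by
  obtain ⟨⟨a, rfl⟩, hv⟩ := hf
  simp only [mem_planeLine, Fin.sum_univ_two, map_add, map_mul, eval_C, eval_X] at hv
  have h1 : a 0 * d = a 1 * c := by
    have := (hv ![d, -c]).1 (by simp; ring)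
    simp at this
    linear_combination this
  obtain ⟨k, hk0, hk1⟩ : ∃ k, a 0 = k * c ∧ a 1 = k * d := by
    by_cases hc : c = 0
    · have hd : d ≠ 0 := h.resolve_left (not_not.2 hc)
      subst hc
      exact ⟨a 1 / d, by simpa [hd] using h1, by field_simp⟩
    · exact ⟨a 0 / c, by field_simp, by field_simp; linear_combination -h1⟩
  refine ⟨k, ?_, ?_⟩
  · rintro rfl
    have h2 := (hv ![1, 0]).2 (by simp [hk0])
    have h3 := (hv ![0, 1]).2 (by simp [hk1])
    simp at h2 h3
    tauto
  · rw [Fin.sum_univ_two, hk0, hk1, map_mul, map_mul]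
    ring

lemma mul_eq_self_iff_eq_zero {u : ℂ} (hu : u ≠ 1) (x : ℂ) : x * u = x ↔ x = 0 := by
  constructor
  · intro h
    have : x * (u - 1) = 0 := by linear_combination h
    exact (mul_eq_zero.1 this).resolve_right (sub_ne_zero.2 hu)
  · rintro rfl
    rw [zero_mul]

lemma vecMul_diag (u w : ℂ) (v : Fin 2 → ℂ) :
    Matrix.vecMul v !![u, 0; 0, w] = v ↔ v 0 * u = v 0 ∧ v 1 * w = v 1 := by
  rw [funext_iff, Fin.forall_fin_two]
  simp [Matrix.vecMul, dotProduct, Fin.sum_univ_two]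

lemma vecMul_antidiag (u w : ℂ) (v : Fin 2 → ℂ) :
    Matrix.vecMul v !![0, w; u, 0] = v ↔ v 1 * u = v 0 ∧ v 0 * w = v 1 := by
  rw [funext_iff, Fin.forall_fin_two]
  simp [Matrix.vecMul, dotProduct, Fin.sum_univ_two]

section Arrangement

variable {m p q : ℕ}

lemma reflectingHyperplanes_eq (hm : 0 < m) (hmpq : m = p * q) (hq2 : 2 ≤ q) :
    reflectingHyperplanes (imprimitiveGroup m p 2) =
      insert (planeLine 1 0) (insert (planeLine 0 1)
        ((fun a : ℂ => planeLine 1 (-a)) '' {a | a ^ m = 1})) := by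
  have hp0 : 0 < p := Nat.pos_of_ne_zero (by rintro rfl; simp at hmpq; omega)
  have hmp : m / p = q := by rw [hmpq, Nat.mul_div_cancel_left _ hp0]
  have hζ := Complex.isPrimitiveRoot_exp q (by omega)
  set ζ := Complex.exp (2 * Real.pi * Complex.I / q)
  have hζm : ζ ^ m = 1 := by rw [hmpq, mul_comm, pow_mul, hζ.pow_eq_one, one_pow]
  have hζ1 : ζ ≠ 1 := hζ.ne_one (by omega)
  ext L
  constructor
  · rintro ⟨hfr, g, hg, hL⟩
    have hLbot : L ≠ ⊥ := by rintro rfl; simp at hfr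
    have hLtop : L ≠ ⊤ := by rintro rfl; simp at hfr
    obtain ⟨u, w, hu, hw, huw, h | h⟩ := imprimitiveGroup_two_cases hg
    · simp only [h, vecMul_diag] at hL
      by_cases hu1 : u = 1 <;> by_cases hw1 : w = 1
      · refine absurd ?_ hLtop
        ext v
        simp [hL, hu1, hw1]
      · right; left
        ext v
        rw [hL, mem_planeLine, mul_eq_self_iff_eq_zero hw1]
        simp [hu1]
      · left
        ext v
        rw [hL, mem_planeLine, mul_eq_self_iff_eq_zero hu1]
        simp [hw1]
      · refine absurd ?_ hLbot
        ext v
        rw [hL, Submodule.mem_bot, _root_.funext_iff, Fin.forall_fin_two,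
          mul_eq_self_iff_eq_zero hu1, mul_eq_self_iff_eq_zero hw1]
        rfl
    · simp only [h, vecMul_antidiag] at hL
      by_cases huw1 : u * w = 1
      · refine Or.inr (Or.inr ⟨u, hu, ?_⟩)
        ext v
        rw [hL, mem_planeLine]
        constructor
        · intro h1
          have h2 : v 1 * u = v 0 := by linear_combination -h1
          exact ⟨h2, by rw [← h2]; linear_combination v 1 * huw1⟩
        · rintro ⟨h1, -⟩
          linear_combination -h1
      · refine absurd ?_ hLbot
        ext v
        rw [hL, Submodule.mem_bot, _root_.funext_iff, Fin.forall_fin_two]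
        constructor
        · rintro ⟨h1, h2⟩
          have h3 : v 0 = 0 := by
            have h4 : v 0 * (u * w - 1) = 0 := by linear_combination u * h2 + h1
            exact (mul_eq_zero.1 h4).resolve_right (sub_ne_zero.2 huw1)
          exact ⟨h3, by rw [← h2, h3, zero_mul]; rfl⟩
        · rintro ⟨h1, h2⟩
          simp [h1, h2]
  · rintro (rfl | rfl | ⟨a, ha, rfl⟩)
    · obtain ⟨g, hg⟩ := exists_diag_mem (m := m) (p := p) hm (u := ζ) (v := 1) hζm (by simp)
        (by rw [mul_one, hmp, hζ.pow_eq_one])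
      refine ⟨finrank_planeLine (by simp), g, g.2, fun v => ?_⟩
      rw [hg, vecMul_diag, mem_planeLine, mul_eq_self_iff_eq_zero hζ1]
      simp
    · obtain ⟨g, hg⟩ := exists_diag_mem (m := m) (p := p) hm (u := 1) (v := ζ) (by simp) hζm
        (by rw [one_mul, hmp, hζ.pow_eq_one])
      refine ⟨finrank_planeLine (by simp), g, g.2, fun v => ?_⟩
      rw [hg, vecMul_diag, mem_planeLine, mul_eq_self_iff_eq_zero hζ1]
      simp
    · have ha' : a ^ m = 1 := ha
      have ha0 : a ≠ 0 := by rintro rfl; simp [hm.ne'] at ha'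
      obtain ⟨g, hg⟩ := exists_antidiag_mem (m := m) (p := p) hm (u := a) (v := a⁻¹) ha'
        (by rw [inv_pow, ha', inv_one]) (by rw [mul_inv_cancel₀ ha0, one_pow])
      refine ⟨finrank_planeLine (by simp), g, g.2, fun v => ?_⟩
      rw [hg, vecMul_antidiag, mem_planeLine]
      constructor
      · intro h1
        have h2 : v 1 * a = v 0 := by linear_combination -h1
        exact ⟨h2, by rw [← h2]; field_simp⟩
      · rintro ⟨h1, -⟩
        linear_combination -h1

lemma fixerOrder_eq_ncard {n : ℕ} (G : Subgroup (GL (Fin n) ℂ)) (L : Submodule ℂ (Fin n → ℂ))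
    (f : GL (Fin n) ℂ → ℂ) {s : Set ℂ}
    (hs : f '' {g | g ∈ G ∧ ∀ v ∈ L, Matrix.vecMul v (g : Matrix (Fin n) (Fin n) ℂ) = v} = s)
    (hf : Set.InjOn f
      {g | g ∈ G ∧ ∀ v ∈ L, Matrix.vecMul v (g : Matrix (Fin n) (Fin n) ℂ) = v}) :
    fixerOrder G L = s.ncard := by
  rw [← hs, hf.ncard_image]
  rfl

lemma ncard_pow_eq_one {n : ℕ} (hn : 0 < n) : {a : ℂ | a ^ n = 1}.ncard = n := by
  have h : {a : ℂ | a ^ n = 1} = (Polynomial.nthRootsFinset n (1 : ℂ) : Set ℂ) := by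
    ext a
    simp [Polynomial.mem_nthRootsFinset hn]
  rw [h, Set.ncard_coe_finset, (Complex.isPrimitiveRoot_exp n hn.ne').card_nthRootsFinset]

lemma fixerOrder_planeLine_one_zero (hm : 0 < m) (hmpq : m = p * q) :
    fixerOrder (imprimitiveGroup m p 2) (planeLine 1 0) = q := by
  have hp0 : 0 < p := Nat.pos_of_ne_zero (by rintro rfl; simp at hmpq; omega)
  have hq0 : 0 < q := Nat.pos_of_ne_zero (by rintro rfl; omega)
  have hmp : m / p = q := by rw [hmpq, Nat.mul_div_cancel_left _ hp0]
  have key : ∀ g : GL (Fin 2) ℂ, g ∈ imprimitiveGroup m p 2 →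
      (∀ v ∈ planeLine 1 0, Matrix.vecMul v (g : Matrix (Fin 2) (Fin 2) ℂ) = v) →
      ∃ u : ℂ, u ^ q = 1 ∧ (g : Matrix (Fin 2) (Fin 2) ℂ) = !![u, 0; 0, 1] := by
    intro g hg hfix
    have h1 := hfix ![0, 1] (by simp [mem_planeLine])
    obtain ⟨u, w, hu, hw, huw, h | h⟩ := imprimitiveGroup_two_cases hg
    · rw [h, vecMul_diag] at h1
      have hw1 : w = 1 := by simpa using h1.2
      rw [hw1, mul_one, hmp] at huw
      exact ⟨u, huw, by rw [h, hw1]⟩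
    · rw [h, vecMul_antidiag] at h1
      simp at h1
  rw [fixerOrder_eq_ncard _ _ (fun g => (g : Matrix (Fin 2) (Fin 2) ℂ) 0 0)
    (s := {a | a ^ q = 1}) ?_ ?_, ncard_pow_eq_one hq0]
  · ext a
    constructor
    · rintro ⟨g, ⟨hg, hfix⟩, rfl⟩
      obtain ⟨u, hu, h⟩ := key g hg hfix
      simpa [h] using hu
    · intro ha
      have ha' : a ^ q = 1 := ha
      obtain ⟨g, hg⟩ := exists_diag_mem (m := m) (p := p) hm (u := a) (v := 1)
        (by rw [hmpq, mul_comm, pow_mul, ha', one_pow]) (by simp) (by rw [mul_one, hmp, ha'])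
      refine ⟨g, ⟨g.2, fun v hv => ?_⟩, by simp [hg]⟩
      rw [mem_planeLine] at hv
      rw [hg, vecMul_diag]
      have : v 0 = 0 := by simpa using hv
      simp [this]
  · rintro g ⟨hg, hfix⟩ g' ⟨hg', hfix'⟩ hgg
    obtain ⟨u, hu, h⟩ := key g hg hfix
    obtain ⟨u', hu', h'⟩ := key g' hg' hfix'
    have : u = u' := by simpa [h, h'] using hgg
    exact Units.ext (by rw [h, h', this])

lemma fixerOrder_planeLine_zero_one (hm : 0 < m) (hmpq : m = p * q) :
    fixerOrder (imprimitiveGroup m p 2) (planeLine 0 1) = q := by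
  have hp0 : 0 < p := Nat.pos_of_ne_zero (by rintro rfl; simp at hmpq; omega)
  have hq0 : 0 < q := Nat.pos_of_ne_zero (by rintro rfl; omega)
  have hmp : m / p = q := by rw [hmpq, Nat.mul_div_cancel_left _ hp0]
  have key : ∀ g : GL (Fin 2) ℂ, g ∈ imprimitiveGroup m p 2 →
      (∀ v ∈ planeLine 0 1, Matrix.vecMul v (g : Matrix (Fin 2) (Fin 2) ℂ) = v) →
      ∃ u : ℂ, u ^ q = 1 ∧ (g : Matrix (Fin 2) (Fin 2) ℂ) = !![1, 0; 0, u] := by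
    intro g hg hfix
    have h1 := hfix ![1, 0] (by simp [mem_planeLine])
    obtain ⟨u, w, hu, hw, huw, h | h⟩ := imprimitiveGroup_two_cases hg
    · rw [h, vecMul_diag] at h1
      have hu1 : u = 1 := by simpa using h1.1
      rw [hu1, one_mul, hmp] at huw
      exact ⟨w, huw, by rw [h, hu1]⟩
    · rw [h, vecMul_antidiag] at h1
      simp at h1
  rw [fixerOrder_eq_ncard _ _ (fun g => (g : Matrix (Fin 2) (Fin 2) ℂ) 1 1)
    (s := {a | a ^ q = 1}) ?_ ?_, ncard_pow_eq_one hq0]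
  · ext a
    constructor
    · rintro ⟨g, ⟨hg, hfix⟩, rfl⟩
      obtain ⟨u, hu, h⟩ := key g hg hfix
      simpa [h] using hu
    · intro ha
      have ha' : a ^ q = 1 := ha
      obtain ⟨g, hg⟩ := exists_diag_mem (m := m) (p := p) hm (u := 1) (v := a) (by simp)
        (by rw [hmpq, mul_comm, pow_mul, ha', one_pow]) (by rw [one_mul, hmp, ha'])
      refine ⟨g, ⟨g.2, fun v hv => ?_⟩, by simp [hg]⟩
      rw [mem_planeLine] at hv
      rw [hg, vecMul_diag]
      have : v 1 = 0 := by simpa using hv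
      simp [this]
  · rintro g ⟨hg, hfix⟩ g' ⟨hg', hfix'⟩ hgg
    obtain ⟨u, hu, h⟩ := key g hg hfix
    obtain ⟨u', hu', h'⟩ := key g' hg' hfix'
    have : u = u' := by simpa [h, h'] using hgg
    exact Units.ext (by rw [h, h', this])

lemma fixerOrder_planeLine_one_neg (hm : 0 < m) {a : ℂ} (ha : a ^ m = 1) :
    fixerOrder (imprimitiveGroup m p 2) (planeLine 1 (-a)) = 2 := by
  have ha0 : a ≠ 0 := by rintro rfl; simp [hm.ne'] at ha
  have key : ∀ g : GL (Fin 2) ℂ, g ∈ imprimitiveGroup m p 2 →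
      (∀ v ∈ planeLine 1 (-a), Matrix.vecMul v (g : Matrix (Fin 2) (Fin 2) ℂ) = v) →
      (g : Matrix (Fin 2) (Fin 2) ℂ) = !![1, 0; 0, 1] ∨
        (g : Matrix (Fin 2) (Fin 2) ℂ) = !![0, a⁻¹; a, 0] := by
    intro g hg hfix
    have h1 := hfix ![a, 1] (by simp [mem_planeLine])
    obtain ⟨u, w, hu, hw, huw, h | h⟩ := imprimitiveGroup_two_cases hg
    · rw [h, vecMul_diag] at h1
      left
      have hu1 : u = 1 := by simpa [ha0] using h1.1
      have hw1 : w = 1 := by simpa using h1.2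
      rw [h, hu1, hw1]
    · rw [h, vecMul_antidiag] at h1
      right
      have hu1 : u = a := by simpa using h1.1
      have hw1 : a * w = 1 := by simpa using h1.2
      rw [h, hu1, eq_inv_of_mul_eq_one_right hw1]
  rw [fixerOrder_eq_ncard _ _ (fun g => (g : Matrix (Fin 2) (Fin 2) ℂ) 0 0)
    (s := {1, 0}) ?_ ?_, Set.ncard_pair one_ne_zero]
  · ext b
    constructor
    · rintro ⟨g, ⟨hg, hfix⟩, rfl⟩
      rcases key g hg hfix with h | h <;> simp [h]
    · rintro (rfl | rfl)
      · exact ⟨1, ⟨one_mem _, by simp⟩, by simp⟩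
      · obtain ⟨g, hg⟩ := exists_antidiag_mem (m := m) (p := p) hm (u := a) (v := a⁻¹) ha
          (by rw [inv_pow, ha, inv_one]) (by rw [mul_inv_cancel₀ ha0, one_pow])
        refine ⟨g, ⟨g.2, fun v hv => ?_⟩, by simp [hg]⟩
        rw [mem_planeLine] at hv
        rw [hg, vecMul_antidiag]
        have h2 : v 1 * a = v 0 := by linear_combination -hv
        exact ⟨h2, by rw [← h2]; field_simp⟩
  · rintro g ⟨hg, hfix⟩ g' ⟨hg', hfix'⟩ hgg
    apply Units.ext
    rcases key g hg hfix with h | h <;> rcases key g' hg' hfix' with h' | h' <;>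
      simp [h, h'] at hgg ⊢

lemma prod_X_sub_C_mul_X (hm : 0 < m) :
    ∏ a ∈ Polynomial.nthRootsFinset m (1 : ℂ), (X 0 - C a * X 1 : MvPolynomial (Fin 2) ℂ) =
      X 0 ^ m - X 1 ^ m := by
  have hζ := Complex.isPrimitiveRoot_exp m hm.ne'
  have hζ' := hζ.map_of_injective (f := (C : ℂ →+* MvPolynomial (Fin 2) ℂ)) (C_injective _ _)
  rw [hζ'.pow_sub_pow_eq_prod_sub_mul _ _ hm]
  refine Finset.prod_bij (fun a _ => C a) ?_ ?_ ?_ ?_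
  · intro a ha
    rw [Polynomial.mem_nthRootsFinset hm] at ha ⊢
    rw [← map_pow, ha, map_one]
  · intro a _ b _ hab
    exact C_injective _ _ hab
  · intro b hb
    rw [Polynomial.mem_nthRootsFinset hm] at hb
    obtain ⟨i, -, hi⟩ := haveI : NeZero m := ⟨hm.ne'⟩; hζ'.eq_pow_of_pow_eq_one hb
    refine ⟨_, ?_, by rw [map_pow]; exact hi⟩
    rw [Polynomial.mem_nthRootsFinset hm, pow_right_comm, hζ.pow_eq_one, one_pow]
  · intro a _
    rfl

lemma exists_prod_reflectingHyperplanes_eq (hm : 0 < m) (hmpq : m = p * q) (hq2 : 2 ≤ q)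
    {α : Submodule ℂ (Fin 2 → ℂ) → MvPolynomial (Fin 2) ℂ}
    (hα : ∀ H ∈ reflectingHyperplanes (imprimitiveGroup m p 2), IsDefiningForm H (α H))
    (e : Submodule ℂ (Fin 2 → ℂ) → ℕ) {a b : ℕ} (h₀ : e (planeLine 1 0) = a)
    (h₁ : e (planeLine 0 1) = a) (h₂ : ∀ c : ℂ, c ^ m = 1 → e (planeLine 1 (-c)) = b) :
    ∃ k : ℂ, k ≠ 0 ∧ ∏ᶠ H ∈ reflectingHyperplanes (imprimitiveGroup m p 2), α H ^ e H =
      C k * ((X 0 * X 1) ^ a * (X 0 ^ m - X 1 ^ m) ^ b) := by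
  rw [reflectingHyperplanes_eq hm hmpq hq2] at hα ⊢
  have hroots : {a : ℂ | a ^ m = 1} = (Polynomial.nthRootsFinset m (1 : ℂ) : Set ℂ) := by
    ext a
    simp [Polynomial.mem_nthRootsFinset hm]
  have hfin : ((fun a : ℂ => planeLine 1 (-a)) '' {a | a ^ m = 1}).Finite := by
    rw [hroots]
    exact (Finset.finite_toSet _).image _
  have hinj : Set.InjOn (fun a : ℂ => planeLine 1 (-a)) {a | a ^ m = 1} := by
    intro a _ b _ hab
    have h : ![a, 1] ∈ planeLine 1 (-b) := by
      rw [← show planeLine 1 (-a) = planeLine 1 (-b) from hab, mem_planeLine]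
      simp
    rw [mem_planeLine] at h
    simp at h
    linear_combination h
  have hn₁ : planeLine 0 1 ∉ (fun a : ℂ => planeLine 1 (-a)) '' {a | a ^ m = 1} := by
    rintro ⟨a, -, h⟩
    have : ![1, 0] ∈ planeLine 0 1 := by simp [mem_planeLine]
    rw [← show planeLine 1 (-a) = planeLine 0 1 from h, mem_planeLine] at this
    simp at this
  have hn₀ : planeLine 1 0 ∉
      insert (planeLine 0 1) ((fun a : ℂ => planeLine 1 (-a)) '' {a | a ^ m = 1}) := by
    have h01 : ![0, 1] ∈ planeLine 1 0 := by simp [mem_planeLine]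
    rintro (h | ⟨a, ha, h⟩)
    · rw [h, mem_planeLine] at h01
      simp at h01
    · rw [← show planeLine 1 (-a) = planeLine 1 0 from h, mem_planeLine] at h01
      have : a = 0 := by simpa using h01
      rw [this, Set.mem_ofPred_eq, zero_pow hm.ne'] at ha
      exact zero_ne_one ha
  obtain ⟨k₀, hk₀, e₀⟩ := exists_eq_C_mul_of_isDefiningForm (by simp)
    (hα (planeLine 1 0) (Set.mem_insert _ _))
  obtain ⟨k₁, hk₁, e₁⟩ := exists_eq_C_mul_of_isDefiningForm (by simp)
    (hα (planeLine 0 1) (Set.mem_insert_of_mem _ (Set.mem_insert _ _)))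
  have h3 : ∀ c : ℂ, ∃ k : ℂ, k ≠ 0 ∧ (c ^ m = 1 →
      α (planeLine 1 (-c)) = C k * (X 0 - C c * X 1)) := by
    intro c
    by_cases hc : c ^ m = 1
    · obtain ⟨k, hk, e⟩ := exists_eq_C_mul_of_isDefiningForm (by simp)
        (hα (planeLine 1 (-c)) (Set.mem_insert_of_mem _ (Set.mem_insert_of_mem _ ⟨c, hc, rfl⟩)))
      refine ⟨k, hk, fun _ => ?_⟩
      rw [e]
      simp only [map_one, map_neg]
      ring
    · exact ⟨1, one_ne_zero, fun h => absurd h hc⟩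
  choose k hk hkc using h3
  rw [finprod_mem_insert _ hn₀ (hfin.insert _), finprod_mem_insert _ hn₁ hfin,
    finprod_mem_image hinj, hroots, finprod_mem_coe_finset, h₀, h₁, e₀, e₁]
  have h4 : ∏ c ∈ Polynomial.nthRootsFinset m (1 : ℂ),
      α (planeLine 1 (-c)) ^ e (planeLine 1 (-c)) =
      C (∏ c ∈ Polynomial.nthRootsFinset m (1 : ℂ), k c) ^ b * (X 0 ^ m - X 1 ^ m) ^ b := by
    rw [← prod_X_sub_C_mul_X hm, map_prod, ← mul_pow, ← Finset.prod_mul_distrib, ← Finset.prod_pow]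
    refine Finset.prod_congr rfl fun c hc => ?_
    rw [Polynomial.mem_nthRootsFinset hm] at hc
    rw [h₂ c hc, hkc c hc]
  refine ⟨k₀ ^ a * k₁ ^ a * (∏ c ∈ Polynomial.nthRootsFinset m (1 : ℂ), k c) ^ b,
    mul_ne_zero (mul_ne_zero (pow_ne_zero _ hk₀) (pow_ne_zero _ hk₁))
      (pow_ne_zero _ (Finset.prod_ne_zero_iff.2 fun c _ => hk c)), ?_⟩
  rw [h4]
  simp only [map_mul, map_pow, map_one, map_zero]
  ring

lemma exists_arrangementPoly_eq (hm : 0 < m) (hmpq : m = p * q) (hq2 : 2 ≤ q)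
    {α : Submodule ℂ (Fin 2 → ℂ) → MvPolynomial (Fin 2) ℂ}
    (hα : ∀ H ∈ reflectingHyperplanes (imprimitiveGroup m p 2), IsDefiningForm H (α H)) :
    ∃ k : ℂ, k ≠ 0 ∧ arrangementPoly (imprimitiveGroup m p 2) α =
      C k * (X 0 * X 1 * (X 0 ^ m - X 1 ^ m)) := by
  obtain ⟨k, hk, h⟩ := exists_prod_reflectingHyperplanes_eq hm hmpq hq2 hα (fun _ => 1)
    (a := 1) (b := 1) rfl rfl (fun _ _ => rfl)
  refine ⟨k, hk, ?_⟩
  rw [arrangementPoly]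
  simpa only [pow_one] using h

lemma exists_discriminantPoly_eq (hm : 0 < m) (hmpq : m = p * q) (hq2 : 2 ≤ q)
    {α : Submodule ℂ (Fin 2 → ℂ) → MvPolynomial (Fin 2) ℂ}
    (hα : ∀ H ∈ reflectingHyperplanes (imprimitiveGroup m p 2), IsDefiningForm H (α H)) :
    ∃ k : ℂ, k ≠ 0 ∧ discriminantPoly (imprimitiveGroup m p 2) α =
      C k * ((X 0 * X 1) ^ q * (X 0 ^ m - X 1 ^ m) ^ 2) :=
  exists_prod_reflectingHyperplanes_eq hm hmpq hq2 hα _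
    (fixerOrder_planeLine_one_zero hm hmpq) (fixerOrder_planeLine_zero_one hm hmpq)
    (fun _ hc => fixerOrder_planeLine_one_neg hm hc)

end Arrangement

/-! ### Two-dimensional representations and their isotypical components -/

lemma weightedHomogeneousComponent_mul_of_left {σ M : Type} [AddCommGroup M]
    {w : σ → M} {z : MvPolynomial σ ℂ} {k : M} (hz : IsWeightedHomogeneous w z k) (n : M)
    (f : MvPolynomial σ ℂ) :
    weightedHomogeneousComponent w (k + n) (z * f) = z * weightedHomogeneousComponent w n f := by
  classical
  let := weightedGradedAlgebra ℂ w
  have := DirectSum.coe_decompose_mul_add_of_left_mem (weightedHomogeneousSubmodule ℂ w)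
    (i := k) (j := n) (b := f) ((mem_weightedHomogeneousSubmodule ℂ w k z).2 hz)
  simp_rw [← weightedDecomposition.decompose'_apply]
  exact this

section Box

variable {m p q : ℕ}

/-- The representation `ρ` of `G(m,p,2)` is given by the formulas for `resBoxRep m p a b`, up to a
factor `ε` on the elements that are not diagonal. -/
structure IsBoxType (ρ : Representation ℂ (imprimitiveGroup m p 2) (Fin 2 → ℂ)) (a b : ℕ)
    (ε : ℂ) : Prop where
  diag : ∀ (g : imprimitiveGroup m p 2) (u v : ℂ), u ≠ 0 → v ≠ 0 →
    ((g : GL (Fin 2) ℂ) : Matrix (Fin 2) (Fin 2) ℂ) = !![u, 0; 0, v] →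
    ∀ w, ρ g w = ![u ^ a * v ^ b * w 0, u ^ b * v ^ a * w 1]
  antidiag : ∀ (g : imprimitiveGroup m p 2) (u v : ℂ), u ≠ 0 → v ≠ 0 →
    ((g : GL (Fin 2) ℂ) : Matrix (Fin 2) (Fin 2) ℂ) = !![0, v; u, 0] →
    ∀ w, ρ g w = ![ε * (u ^ b * v ^ a * w 1), ε * (u ^ a * v ^ b * w 0)]

lemma isBoxType_resBoxRep (m p a b : ℕ) : IsBoxType (resBoxRep m p a b) a b 1 where
  diag := by
    intro g u v hu hv hg w
    change Matrix.mulVec (boxMatrix a b ((g : GL (Fin 2) ℂ) : Matrix (Fin 2) (Fin 2) ℂ)) w = _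
    rw [hg]
    ext i
    fin_cases i <;>
      simp [boxMatrix, Matrix.mulVec, dotProduct, Fin.sum_univ_two, hu, hv, mul_comm]
  antidiag := by
    intro g u v hu hv hg w
    change Matrix.mulVec (boxMatrix a b ((g : GL (Fin 2) ℂ) : Matrix (Fin 2) (Fin 2) ℂ)) w = _
    rw [hg]
    ext i
    fin_cases i <;>
      simp [boxMatrix, Matrix.mulVec, dotProduct, Fin.sum_univ_two, hu, hv, mul_comm]

lemma IsBoxType.detTwist {ρ : Representation ℂ (imprimitiveGroup m p 2) (Fin 2 → ℂ)} {a b : ℕ}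
    {ε : ℂ} (h : IsBoxType ρ a b ε) : IsBoxType (detTwist _ ρ) (a + 1) (b + 1) (-ε) where
  diag := by
    intro g u v hu hv hg w
    change ((g : GL (Fin 2) ℂ) : Matrix (Fin 2) (Fin 2) ℂ).det • ρ g w = _
    rw [h.diag g u v hu hv hg, hg, Matrix.det_fin_two_of]
    ext i
    fin_cases i <;> simp <;> ring
  antidiag := by
    intro g u v hu hv hg w
    change ((g : GL (Fin 2) ℂ) : Matrix (Fin 2) (Fin 2) ℂ).det • ρ g w = _
    rw [h.antidiag g u v hu hv hg, hg, Matrix.det_fin_two_of]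
    ext i
    fin_cases i <;> simp <;> ring

variable {ρ : Representation ℂ (imprimitiveGroup m p 2) (Fin 2 → ℂ)} {a b : ℕ} {ε : ℂ}

lemma IsBoxType.isIrreducible (hm : 0 < m) (hmpq : m = p * q) (h : IsBoxType ρ a b ε)
    (hε : ε ≠ 0) (hab : wtDeg q m a b ≠ wtDeg q m b a) : ρ.IsIrreducible := by
  have hp0 : 0 < p := Nat.pos_of_ne_zero (by rintro rfl; simp at hmpq; omega)
  have hmp : m / p = q := by rw [hmpq, Nat.mul_div_cancel_left _ hp0]
  obtain ⟨u, v, hu, hv, huv, hne⟩ : ∃ u v : ℂ, u ^ m = 1 ∧ v ^ m = 1 ∧ (u * v) ^ q = 1 ∧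
      u ^ a * v ^ b ≠ u ^ b * v ^ a := by
    by_contra! hcon
    exact hab (wtDeg_eq_of_pow_mul_pow_eq hm hmpq hcon)
  obtain ⟨g, hg⟩ := exists_diag_mem (p := p) hm hu hv (by rwa [hmp])
  obtain ⟨s, hs⟩ := exists_antidiag_mem (m := m) (p := p) hm (u := 1) (v := 1) (by simp) (by simp)
    (by simp)
  have hu0 : u ≠ 0 := by rintro rfl; simp [hm.ne'] at hu
  have hv0 : v ≠ 0 := by rintro rfl; simp [hm.ne'] at hv
  have hgw := h.diag g u v hu0 hv0 hg
  have hsw := h.antidiag s 1 1 one_ne_zero one_ne_zero hs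
  simp only [one_pow, one_mul] at hsw
  have hnt : Nontrivial (Subrepresentation ρ) := ⟨⊥, ⊤, fun hbt => by
    have h1 : (![1, 0] : Fin 2 → ℂ) ∈ (⊥ : Subrepresentation ρ) := by
      rw [hbt]; exact Submodule.mem_top
    have h2 : (![1, 0] : Fin 2 → ℂ) = 0 := (Submodule.mem_bot ℂ).1 h1
    have := congrFun h2 0
    simp at this⟩
  refine @IsSimpleOrder.mk _ _ _ hnt fun N => ?_
  set N' := N.toSubmodule with hN'
  have hN : ∀ (g) (w), w ∈ N' → ρ g w ∈ N' := fun g w hw => N.apply_mem_toSubmodule g hw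
  suffices hsuff : N' = ⊥ ∨ N' = ⊤ by
    rcases hsuff with h0 | h0
    · exact Or.inl (Subrepresentation.toSubmodule_injective h0)
    · exact Or.inr (Subrepresentation.toSubmodule_injective h0)
  by_cases hbot : N' = ⊥
  · exact Or.inl hbot
  right
  obtain ⟨w, hw, hw0⟩ := N'.ne_bot_iff.1 hbot
  have hboth : (![1, 0] : Fin 2 → ℂ) ∈ N' ∧ (![0, 1] : Fin 2 → ℂ) ∈ N' := by
    have hx : (![w 0, 0] : Fin 2 → ℂ) ∈ N' := by
      have h1 : (u ^ a * v ^ b - u ^ b * v ^ a)⁻¹ • (ρ g w - (u ^ b * v ^ a) • w) ∈ N' :=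
        N'.smul_mem _ (N'.sub_mem (hN g w hw) (N'.smul_mem _ hw))
      convert h1 using 1
      have := sub_ne_zero.2 hne
      rw [hgw]
      ext i
      fin_cases i
      · change w 0 = (u ^ a * v ^ b - u ^ b * v ^ a)⁻¹ *
          (u ^ a * v ^ b * w 0 - u ^ b * v ^ a * w 0)
        field_simp
      · change 0 = (u ^ a * v ^ b - u ^ b * v ^ a)⁻¹ *
          (u ^ b * v ^ a * w 1 - u ^ b * v ^ a * w 1)
        ring
    have hy : (![0, w 1] : Fin 2 → ℂ) ∈ N' := by
      have : (![0, w 1] : Fin 2 → ℂ) = w - ![w 0, 0] := by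
        ext i; fin_cases i <;> simp
      rw [this]
      exact N'.sub_mem hw hx
    by_cases hw00 : w 0 = 0
    · have hw1 : w 1 ≠ 0 := fun hw1 => hw0 (by ext i; fin_cases i <;> simpa)
      have h1 : (![0, 1] : Fin 2 → ℂ) ∈ N' := by
        have := N'.smul_mem (w 1)⁻¹ hy
        simpa [hw1] using this
      refine ⟨?_, h1⟩
      have := N'.smul_mem ε⁻¹ (hN s _ h1)
      rw [hsw] at this
      simpa [hε] using this
    · have h1 : (![1, 0] : Fin 2 → ℂ) ∈ N' := by
        have := N'.smul_mem (w 0)⁻¹ hx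
        simpa [hw00] using this
      refine ⟨h1, ?_⟩
      have := N'.smul_mem ε⁻¹ (hN s _ h1)
      rw [hsw] at this
      simpa [hε] using this
  refine Submodule.eq_top_iff'.2 fun x => ?_
  have := N'.add_mem (N'.smul_mem (x 0) hboth.1) (N'.smul_mem (x 1) hboth.2)
  convert this using 1
  ext i
  fin_cases i <;> simp

lemma IsBoxType.mem_isotypic_iff (hm : 0 < m) (hmpq : m = p * q) (h : IsBoxType ρ a b ε)
    (hε : ε * ε = 1) {f : MvPolynomial (Fin 2) ℂ} :
    f ∈ isotypic (imprimitiveGroup m p 2) ρ ↔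
      ∃ f₀ f₁, IsWeightedHomogeneous (wt q m) f₀ (wtDeg q m a b) ∧
        IsWeightedHomogeneous (wt q m) f₁ (wtDeg q m a b) ∧ f = f₀ + swapVars f₁ := by
  have hp0 : 0 < p := Nat.pos_of_ne_zero (by rintro rfl; simp at hmpq; omega)
  have hmp : m / p = q := by rw [hmpq, Nat.mul_div_cancel_left _ hp0]
  have hne : ∀ u : ℂ, u ^ m = 1 → u ≠ 0 := fun u hu => by rintro rfl; simp [hm.ne'] at hu
  change f ∈ (⨆ F : Representation.IntertwiningMap ρ (symRep (imprimitiveGroup m p 2)),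
    LinearMap.range F.toLinearMap) ↔ _
  constructor
  · intro hf
    set W := weightedHomogeneousSubmodule ℂ (wt q m) (wtDeg q m a b) with hW
    have hle : (⨆ F : Representation.IntertwiningMap ρ (symRep (imprimitiveGroup m p 2)),
        LinearMap.range F.toLinearMap) ≤ W ⊔ W.map swapVars.toLinearMap := by
      refine iSup_le fun F => ?_
      rintro _ ⟨w, rfl⟩
      have hF : ∀ g w, F.toLinearMap (ρ g w) = symRep _ g (F.toLinearMap w) := fun g w =>
        LinearMap.congr_fun (F.isIntertwining' g) w
      have h0 : F.toLinearMap ![1, 0] ∈ W := by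
        rw [hW, mem_weightedHomogeneousSubmodule]
        refine isWeightedHomogeneous_of_scaleVars hm hmpq fun u v hu hv huv => ?_
        obtain ⟨g, hg⟩ := exists_diag_mem (p := p) hm hu hv (by rwa [hmp])
        rw [← symRep_of_diag hg, ← hF, h.diag g u v (hne u hu) (hne v hv) hg, ← smul_eq_C_mul,
          ← map_smul]
        congr 1
        ext i
        fin_cases i <;> simp
      obtain ⟨s, hs⟩ := exists_antidiag_mem (m := m) (p := p) hm (u := 1) (v := 1) (by simp)
        (by simp) (by simp)
      have h1 : F.toLinearMap ![0, 1] = swapVars (ε • F.toLinearMap ![1, 0]) := by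
        have h2 := hF s (ε • ![1, 0])
        rw [symRep_of_antidiag hs, h.antidiag s 1 1 one_ne_zero one_ne_zero hs] at h2
        have h3 : scaleVars 1 1 = AlgHom.id ℂ _ := algHom_ext fun i => by fin_cases i <;> simp
        rw [h3, AlgHom.id_apply, map_smul F.toLinearMap] at h2
        rw [← h2]
        congr 1
        ext i
        fin_cases i <;> simp [hε]
      have h4 : w = w 0 • ![1, 0] + w 1 • ![0, 1] := by
        ext i; fin_cases i <;> simp
      rw [h4, map_add, map_smul, map_smul, h1]
      exact Submodule.add_mem_sup (W.smul_mem _ h0) (Submodule.smul_mem _ _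
        ⟨_, W.smul_mem _ h0, rfl⟩)
    obtain ⟨f₀, hf₀, f₁, ⟨f₁, hf₁, rfl⟩, rfl⟩ := Submodule.mem_sup.1 (hle hf)
    exact ⟨f₀, f₁, hf₀, hf₁, rfl⟩
  · rintro ⟨f₀, f₁, hf₀, hf₁, rfl⟩
    have key : ∀ f : MvPolynomial (Fin 2) ℂ,
        IsWeightedHomogeneous (wt q m) f (wtDeg q m a b) → ∀ w : Fin 2 → ℂ,
        C (w 0) * f + C (w 1 * ε) * swapVars f ∈
          (⨆ F : Representation.IntertwiningMap ρ (symRep (imprimitiveGroup m p 2)),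
            LinearMap.range F.toLinearMap) := by
      intro f hf w
      have hf' := isWeightedHomogeneous_swapVars hm hmpq hf
      have hqm : q ∣ m := Dvd.intro_left p hmpq.symm
      let L : (Fin 2 → ℂ) →ₗ[ℂ] MvPolynomial (Fin 2) ℂ :=
        { toFun := fun w => C (w 0) * f + C (w 1 * ε) * swapVars f
          map_add' := fun x y => by
            simp only [Pi.add_apply, map_add, map_mul]
            ring
          map_smul' := fun r x => by
            simp only [Pi.smul_apply, smul_eq_mul, map_mul, RingHom.id_apply, smul_eq_C_mul]
            ring }
      let F : Representation.IntertwiningMap ρ (symRep (imprimitiveGroup m p 2)) :=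
        ⟨L, by
          intro g
          refine LinearMap.ext fun w => ?_
          obtain ⟨u, v, hu, hv, huv, hg | hg⟩ := imprimitiveGroup_two_cases g.2
          all_goals
            rw [hmp] at huv
            have e1 := scaleVars_of_isWeightedHomogeneous hm hqm hf hu huv
            have e2 := scaleVars_of_isWeightedHomogeneous hm hqm hf' hu huv
          · change C (ρ g w 0) * f + C (ρ g w 1 * ε) * swapVars f =
              symRep _ g (C (w 0) * f + C (w 1 * ε) * swapVars f)
            rw [symRep_of_diag hg, h.diag g u v (hne u hu) (hne v hv) hg]
            simp only [map_add, map_mul, scaleVars_C, e1, e2, Matrix.cons_val_zero,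
              Matrix.cons_val_one]
            ring
          · change C (ρ g w 0) * f + C (ρ g w 1 * ε) * swapVars f =
              symRep _ g (C (w 0) * f + C (w 1 * ε) * swapVars f)
            have hε' : (C ε * C ε : MvPolynomial (Fin 2) ℂ) = 1 := by rw [← map_mul, hε, map_one]
            rw [symRep_of_antidiag hg, h.antidiag g u v (hne u hu) (hne v hv) hg]
            simp only [map_add, map_mul, scaleVars_C, swapVars_C, e1, e2, Matrix.cons_val_zero,
              Matrix.cons_val_one, swapVars_swapVars]
            linear_combination C (u ^ a) * C (v ^ b) * C (w 0) * swapVars f * hε'⟩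
      exact (le_iSup (fun F : Representation.IntertwiningMap ρ
        (symRep (imprimitiveGroup m p 2)) => LinearMap.range F.toLinearMap) F) ⟨w, rfl⟩
    refine Submodule.add_mem _ ?_ ?_
    · simpa using key f₀ hf₀ ![1, 0]
    · simpa [hε] using key f₁ hf₁ ![0, ε]

end Box

/-! ### Presentation of the modules `M_χ` -/

section Presentation

/-- The cokernel of `φ` over `R` is already defined over `R/(D)`, if `φ` is a factor of `D`. -/
lemma ker_mkQ_comp_eq_range {R : Type} [CommRing R] {D : R} {φ ψ : Matrix (Fin 2) (Fin 2) R}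
    (h : φ * ψ = D • 1) (r : Fin 2 → R) :
    (Submodule.Quotient.mk (fun i => Ideal.Quotient.mk (Ideal.span {D}) (r i)) :
      Coker (φ.map (Ideal.Quotient.mk (Ideal.span {D})))) = 0 ↔ ∃ s, φ.mulVec s = r := by
  rw [Submodule.Quotient.mk_eq_zero]
  constructor
  · rintro ⟨w, hw⟩
    choose s hs using fun i => Ideal.Quotient.mk_surjective (I := Ideal.span {D}) (w i)
    have h1 : ∀ i, ∃ c, r i - φ.mulVec s i = D * c := fun i => by
      refine (Ideal.Quotient.eq_zero_iff_dvd _ _).1 ?_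
      rw [map_sub, RingHom.map_mulVec, sub_eq_zero]
      have : (Ideal.Quotient.mk (Ideal.span {D})) ∘ s = w := _root_.funext hs
      rw [this]
      exact (congrFun hw i).symm
    choose c hc using h1
    refine ⟨s + ψ.mulVec c, ?_⟩
    rw [Matrix.mulVec_add, Matrix.mulVec_mulVec, h, Matrix.smul_mulVec, Matrix.one_mulVec]
    ext i
    simp only [Pi.add_apply, Pi.smul_apply, smul_eq_mul]
    linear_combination -hc i
  · rintro ⟨s, rfl⟩
    refine ⟨fun i => Ideal.Quotient.mk (Ideal.span {D}) (s i), ?_⟩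
    ext i
    rw [Matrix.mulVecLin_apply, RingHom.map_mulVec]
    rfl

variable {m p q : ℕ}

lemma invRing_smul_def (r : InvRing (imprimitiveGroup m p 2)) (f : MvPolynomial (Fin 2) ℂ) :
    r • f = InvRing.incl _ r * f := rfl

/-- `swapVars` is linear over the invariant ring. -/
noncomputable def swapLin (hm : 0 < m) (hmpq : m = p * q) :
    MvPolynomial (Fin 2) ℂ →ₗ[InvRing (imprimitiveGroup m p 2)] MvPolynomial (Fin 2) ℂ where
  toFun := swapVars
  map_add' := map_add _
  map_smul' r f := by
    rw [invRing_smul_def, map_mul, swapVars_incl hm hmpq]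
    rfl

lemma isWeightedHomogeneous_smul (hm : 0 < m) (hmpq : m = p * q) {n : ZMod q × ZMod m}
    (r : InvRing (imprimitiveGroup m p 2)) {f : MvPolynomial (Fin 2) ℂ}
    (hf : IsWeightedHomogeneous (wt q m) f n) : IsWeightedHomogeneous (wt q m) (r • f) n := by
  have := (incl_isWeightedHomogeneous hm hmpq r).mul hf
  rwa [zero_add] at this

/-- Projection to a weight space, as a map that is linear over the invariant ring. -/
noncomputable def weightProj (hm : 0 < m) (hmpq : m = p * q) (n : ZMod q × ZMod m) :
    MvPolynomial (Fin 2) ℂ →ₗ[InvRing (imprimitiveGroup m p 2)] MvPolynomial (Fin 2) ℂ where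
  toFun := weightedHomogeneousComponent (wt q m) n
  map_add' := map_add _
  map_smul' r f := by
    have := weightedHomogeneousComponent_mul_of_left (incl_isWeightedHomogeneous hm hmpq r) n f
    rwa [zero_add] at this

lemma isWeightedHomogeneous_linearCombination (hm : 0 < m) (hmpq : m = p * q)
    {n : ZMod q × ZMod m} {v : Fin 2 → MvPolynomial (Fin 2) ℂ}
    (hv : ∀ l, IsWeightedHomogeneous (wt q m) (v l) n)
    (r : Fin 2 → InvRing (imprimitiveGroup m p 2)) :
    IsWeightedHomogeneous (wt q m)
      (Fintype.linearCombination (InvRing (imprimitiveGroup m p 2)) v r) n := by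
  rw [Fintype.linearCombination_apply]
  exact IsWeightedHomogeneous.sum _ _ _ fun l _ => isWeightedHomogeneous_smul hm hmpq _ (hv l)

/-- The polynomials `v 0`, `v 1` form a basis of the weight space of weight `n` over the ring of
invariants of `G(m,p,2)`. -/
structure IsWeightBasis (p : ℕ) {q m : ℕ} (n : ZMod q × ZMod m)
    (v : Fin 2 → MvPolynomial (Fin 2) ℂ) : Prop where
  hom : ∀ l, IsWeightedHomogeneous (wt q m) (v l) n
  span : ∀ f, IsWeightedHomogeneous (wt q m) f n →
    ∃ r, Fintype.linearCombination (InvRing (imprimitiveGroup m p 2)) v r = f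
  inj : Function.Injective (Fintype.linearCombination (InvRing (imprimitiveGroup m p 2)) v)

lemma IsWeightBasis.neg_snd {n : ZMod q × ZMod m} {x y : MvPolynomial (Fin 2) ℂ}
    (h : IsWeightBasis p n ![x, y]) : IsWeightBasis p n ![x, -y] where
  hom := by
    intro l
    fin_cases l
    · exact h.hom 0
    · exact (h.hom 1).neg
  span := by
    intro f hf
    obtain ⟨r, rfl⟩ := h.span f hf
    exact ⟨![r 0, -r 1], by simp [Fintype.linearCombination_apply, Fin.sum_univ_two]⟩
  inj := by
    intro r r' hr
    have : (![r 0, -r 1] : Fin 2 → InvRing (imprimitiveGroup m p 2)) = ![r' 0, -r' 1] := h.inj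
      (by simpa [Fintype.linearCombination_apply, Fin.sum_univ_two] using hr)
    ext1 i
    fin_cases i
    · exact congrFun this 0
    · exact neg_injective (congrFun this 1)

lemma IsWeightBasis.swap {n : ZMod q × ZMod m} {x y : MvPolynomial (Fin 2) ℂ}
    (h : IsWeightBasis p n ![x, y]) : IsWeightBasis p n ![y, x] where
  hom := by
    intro l
    fin_cases l
    · exact h.hom 1
    · exact h.hom 0
  span := by
    intro f hf
    obtain ⟨r, rfl⟩ := h.span f hf
    exact ⟨![r 1, r 0], by simp [Fintype.linearCombination_apply, Fin.sum_univ_two, add_comm]⟩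
  inj := by
    intro r r' hr
    have : (![r 1, r 0] : Fin 2 → InvRing (imprimitiveGroup m p 2)) = ![r' 1, r' 0] := h.inj
      (by simpa [Fintype.linearCombination_apply, Fin.sum_univ_two, add_comm] using hr)
    ext1 i
    fin_cases i
    · exact congrFun this 1
    · exact congrFun this 0

variable {ρ : Representation ℂ (imprimitiveGroup m p 2) (Fin 2 → ℂ)} {a b : ℕ}

lemma exists_splitting (hm : 0 < m) (hmpq : m = p * q) (hρ : IsBoxType ρ a b 1)
    (hab : wtDeg q m a b ≠ wtDeg q m b a) {z : MvPolynomial (Fin 2) ℂ}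
    (hz : IsWeightedHomogeneous (wt q m) z (wtDeg q m 1 1)) :
    ∃ π : (MvPolynomial (Fin 2) ℂ ⧸ Ideal.span {z}) →ₗ[InvRing (imprimitiveGroup m p 2)]
        MMod (imprimitiveGroup m p 2) z ρ,
      π ∘ₗ MMod.toQuotient (imprimitiveGroup m p 2) z ρ = LinearMap.id := by
  have hmem := fun f => hρ.mem_isotypic_iff hm hmpq (f := f) (by simp)
  have hmem' := fun f => hρ.detTwist.mem_isotypic_iff hm hmpq (f := f) (by simp)
  have hdeg : ∀ c d : ℕ, wtDeg q m (c + 1) (d + 1) = wtDeg q m 1 1 + wtDeg q m c d := fun c d => by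
    rw [wtDeg_add, add_comm]
  have hab' : wtDeg q m (a + 1) (b + 1) ≠ wtDeg q m (b + 1) (a + 1) := by
    rw [hdeg a b, hdeg b a]
    exact fun h => hab (add_left_cancel h)
  let P₀ : MvPolynomial (Fin 2) ℂ →ₗ[InvRing (imprimitiveGroup m p 2)] MvPolynomial (Fin 2) ℂ :=
    weightProj hm hmpq (wtDeg q m (a + 1) (b + 1)) + weightProj hm hmpq (wtDeg q m (b + 1) (a + 1))
  have hP₀ : ∀ f, P₀ f = weightedHomogeneousComponent (wt q m) (wtDeg q m (a + 1) (b + 1)) f +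
    weightedHomogeneousComponent (wt q m) (wtDeg q m (b + 1) (a + 1)) f := fun f => rfl
  have hhom : ∀ (n) (f : MvPolynomial (Fin 2) ℂ),
      IsWeightedHomogeneous (wt q m) (weightedHomogeneousComponent (wt q m) n f) n := fun n f =>
    weightedHomogeneousComponent_isWeightedHomogeneous n f
  have hmemP : ∀ f, P₀ f ∈ isotypic (imprimitiveGroup m p 2) (detTwist _ ρ) := fun f => by
    refine (hmem' _).2 ⟨_, _, hhom _ f, isWeightedHomogeneous_swapVars hm hmpq (hhom _ f), ?_⟩
    rw [swapVars_swapVars, hP₀]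
  let P₁ := P₀.codRestrict _ hmemP
  let N := ((isotypic (imprimitiveGroup m p 2) ρ).map
    (LinearMap.mulLeft (InvRing (imprimitiveGroup m p 2)) z)).comap
      (isotypic (imprimitiveGroup m p 2) (detTwist _ ρ)).subtype
  have hker : (Ideal.span {z}).restrictScalars (InvRing (imprimitiveGroup m p 2)) ≤
      LinearMap.ker (N.mkQ ∘ₗ P₁) := by
    intro f hf
    obtain ⟨g, rfl⟩ := Ideal.mem_span_singleton'.1 hf
    rw [LinearMap.mem_ker, LinearMap.comp_apply, Submodule.mkQ_apply, Submodule.Quotient.mk_eq_zero]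
    refine ⟨weightedHomogeneousComponent (wt q m) (wtDeg q m a b) g +
      weightedHomogeneousComponent (wt q m) (wtDeg q m b a) g, ?_, ?_⟩
    · refine (hmem _).2 ⟨_, _, hhom _ g, isWeightedHomogeneous_swapVars hm hmpq (hhom _ g), ?_⟩
      rw [swapVars_swapVars]
    · change z * (_ + _) = P₀ (g * z)
      rw [hP₀, mul_comm g z, hdeg a b, hdeg b a, weightedHomogeneousComponent_mul_of_left hz,
        weightedHomogeneousComponent_mul_of_left hz, mul_add]
  refine ⟨(Submodule.liftQ _ (N.mkQ ∘ₗ P₁) hker) ∘ₗ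
    (Submodule.Quotient.restrictScalarsEquiv (InvRing (imprimitiveGroup m p 2))
      (Ideal.span {z})).symm.toLinearMap, ?_⟩
  refine LinearMap.ext fun x => ?_
  obtain ⟨⟨x, hx⟩, rfl⟩ := Submodule.Quotient.mk_surjective _ x
  change N.mkQ (P₁ x) = N.mkQ ⟨x, hx⟩
  congr 1
  refine Subtype.ext ?_
  change P₀ x = x
  obtain ⟨f₀, f₁, hf₀, hf₁, rfl⟩ := (hmem' _).1 hx
  have hf₁' := isWeightedHomogeneous_swapVars hm hmpq hf₁
  rw [hP₀, map_add, map_add, hf₀.weightedHomogeneousComponent_same,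
    hf₁'.weightedHomogeneousComponent_same, hf₀.weightedHomogeneousComponent_ne _ hab'.symm,
    hf₁'.weightedHomogeneousComponent_ne _ hab', add_zero, zero_add]

lemma givesSquareSummand_of_basis (hm : 0 < m) (hmpq : m = p * q) (hρ : IsBoxType ρ a b 1)
    (hab : wtDeg q m a b ≠ wtDeg q m b a) {z : MvPolynomial (Fin 2) ℂ}
    (hz : IsWeightedHomogeneous (wt q m) z (wtDeg q m 1 1)) (hzswap : swapVars z = -z)
    {v w : Fin 2 → MvPolynomial (Fin 2) ℂ}
    (hv : IsWeightBasis p (wtDeg q m (a + 1) (b + 1)) v) (hw : IsWeightBasis p (wtDeg q m a b) w)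
    {D : InvRing (imprimitiveGroup m p 2)}
    {φ ψ : Matrix (Fin 2) (Fin 2) (InvRing (imprimitiveGroup m p 2))} (hφψ : φ * ψ = D • 1)
    {k : ℂ} (hk : k ≠ 0)
    (hzw : ∀ i, z * w i = C k * ∑ l, φ l i • v l)
    {Φ : Matrix (Fin 2) (Fin 2) (InvRing (imprimitiveGroup m p 2) ⧸ Ideal.span {D})}
    (hΦ : Φ = φ.map (Ideal.Quotient.mk (Ideal.span {D}))) :
    GivesSquareSummand (imprimitiveGroup m p 2) z ρ (Coker Φ) := by
  subst hΦ
  refine ⟨hρ.isIrreducible hm hmpq one_ne_zero hab, ?_,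
    exists_splitting hm hmpq hρ hab hz⟩
  have hmem := fun f => hρ.mem_isotypic_iff hm hmpq (f := f) (by simp)
  have hmem' := fun f => hρ.detTwist.mem_isotypic_iff hm hmpq (f := f) (by simp)
  have hdeg : ∀ c d : ℕ, wtDeg q m (c + 1) (d + 1) = wtDeg q m 1 1 + wtDeg q m c d := fun c d => by
    rw [wtDeg_add, add_comm]
  have hab' : wtDeg q m (a + 1) (b + 1) ≠ wtDeg q m (b + 1) (a + 1) := by
    rw [hdeg a b, hdeg b a]
    exact fun h => hab (add_left_cancel h)
  let L := Fintype.linearCombination (InvRing (imprimitiveGroup m p 2)) v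
  have hLhom : ∀ r, IsWeightedHomogeneous (wt q m) (L r) (wtDeg q m (a + 1) (b + 1)) := fun r =>
    isWeightedHomogeneous_linearCombination hm hmpq hv.hom r
  let B : ((Fin 2 → InvRing (imprimitiveGroup m p 2)) ×
      (Fin 2 → InvRing (imprimitiveGroup m p 2))) →ₗ[InvRing (imprimitiveGroup m p 2)]
      MvPolynomial (Fin 2) ℂ :=
    L.coprod (swapLin hm hmpq ∘ₗ L)
  have hB : ∀ r r', B (r, r') = L r + swapVars (L r') := fun r r' => rfl
  have hBinj : Function.Injective B := by
    rw [← LinearMap.ker_eq_bot, LinearMap.ker_eq_bot']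
    rintro ⟨r, r'⟩ h
    rw [hB] at h
    have h1 := isWeightedHomogeneous_swapVars hm hmpq (hLhom r')
    have h2 : L r = 0 := by
      by_contra hne
      refine hab' ((hLhom r).inj_right hne ?_)
      rw [eq_neg_of_add_eq_zero_left h]
      exact h1.neg
    have h3 : L r' = 0 := by
      rw [h2, zero_add] at h
      rw [← swapVars_swapVars (L r'), h, map_zero]
    rw [hv.inj (h2.trans (map_zero L).symm), hv.inj (h3.trans (map_zero L).symm)]
    rfl
  have hBmem : ∀ x, B x ∈ isotypic (imprimitiveGroup m p 2) (detTwist _ ρ) := fun x =>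
    (hmem' _).2 ⟨_, _, hLhom x.1, hLhom x.2, rfl⟩
  let E : ((Fin 2 → InvRing (imprimitiveGroup m p 2)) ×
      (Fin 2 → InvRing (imprimitiveGroup m p 2))) ≃ₗ[InvRing (imprimitiveGroup m p 2)]
      isotypic (imprimitiveGroup m p 2) (detTwist _ ρ) :=
    LinearEquiv.ofBijective (B.codRestrict _ hBmem) ⟨fun x y hxy =>
      hBinj (congrArg Subtype.val hxy), by
        rintro ⟨x, hx⟩
        obtain ⟨f₀, f₁, hf₀, hf₁, rfl⟩ := (hmem' _).1 hx
        obtain ⟨r, rfl⟩ := hv.span f₀ hf₀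
        obtain ⟨r', rfl⟩ := hv.span f₁ hf₁
        exact ⟨(r, r'), rfl⟩⟩
  let θ₀ : (Fin 2 → InvRing (imprimitiveGroup m p 2)) →ₗ[InvRing (imprimitiveGroup m p 2)]
      Coker (φ.map (Ideal.Quotient.mk (Ideal.span {D}))) :=
    { toFun := fun r => Submodule.Quotient.mk fun i => Ideal.Quotient.mk (Ideal.span {D}) (r i)
      map_add' := fun _ _ => rfl
      map_smul' := fun _ _ => rfl }
  have hθ₀ : ∀ r, θ₀ r = 0 ↔ ∃ s, φ.mulVec s = r := fun r => ker_mkQ_comp_eq_range hφψ r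
  have hθ₀surj : Function.Surjective θ₀ := by
    intro y
    obtain ⟨y, rfl⟩ := Submodule.Quotient.mk_surjective _ y
    choose s hs using fun i => Ideal.Quotient.mk_surjective (I := Ideal.span {D}) (y i)
    exact ⟨s, congrArg _ (_root_.funext hs)⟩
  let Θ := (θ₀.prodMap θ₀) ∘ₗ E.symm.toLinearMap
  have hΘsurj : Function.Surjective Θ := (hθ₀surj.prodMap hθ₀surj).comp E.symm.surjective
  have hzL : ∀ s : Fin 2 → InvRing (imprimitiveGroup m p 2),
      z * Fintype.linearCombination (InvRing (imprimitiveGroup m p 2)) w s =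
        C k * L (φ.mulVec s) := by
    intro s
    simp only [L, Fintype.linearCombination_apply, Fin.sum_univ_two, mul_add, Matrix.mulVec,
      dotProduct, invRing_smul_def, map_add, map_mul] at hzw ⊢
    linear_combination InvRing.incl _ (s 0) * hzw 0 + InvRing.incl _ (s 1) * hzw 1
  have hzLswap : ∀ s : Fin 2 → InvRing (imprimitiveGroup m p 2),
      z * swapVars (Fintype.linearCombination (InvRing (imprimitiveGroup m p 2)) w s) =
        -(C k * swapVars (L (φ.mulVec s))) := by
    intro s
    have := congrArg swapVars (hzL s)
    rw [map_mul, map_mul, hzswap, swapVars_C] at this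
    linear_combination -this
  have hCk : ∀ (c : ℂ) (f : MvPolynomial (Fin 2) ℂ),
      (algebraMap ℂ (InvRing (imprimitiveGroup m p 2)) c) • f = C c * f := fun c f => rfl
  have hker : ((isotypic (imprimitiveGroup m p 2) ρ).map
      (LinearMap.mulLeft (InvRing (imprimitiveGroup m p 2)) z)).comap
      (isotypic (imprimitiveGroup m p 2) (detTwist _ ρ)).subtype = LinearMap.ker Θ := by
    ext x
    obtain ⟨⟨r, r'⟩, rfl⟩ := E.surjective x
    have h1 : Θ (E (r, r')) = (θ₀ r, θ₀ r') := by
      change (θ₀.prodMap θ₀) (E.symm (E (r, r'))) = _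
      rw [E.symm_apply_apply]
      rfl
    rw [LinearMap.mem_ker, h1, Prod.mk_eq_zero, hθ₀, hθ₀]
    constructor
    · rintro ⟨g, hg, hgz⟩
      obtain ⟨f₀, f₁, hf₀, hf₁, rfl⟩ := (hmem _).1 hg
      obtain ⟨s, rfl⟩ := hw.span f₀ hf₀
      obtain ⟨s', rfl⟩ := hw.span f₁ hf₁
      have h2 : B (algebraMap ℂ (InvRing (imprimitiveGroup m p 2)) k • φ.mulVec s,
          -(algebraMap ℂ (InvRing (imprimitiveGroup m p 2)) k • φ.mulVec s')) =
          B (r, r') := by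
        refine Eq.trans ?_ (hgz : z * _ = B (r, r'))
        rw [hB, LinearMap.mulLeft_apply, mul_add, hzL, hzLswap, map_neg L, map_smul L, map_smul L,
          hCk, hCk, map_neg,
          map_mul, swapVars_C]
      have h3 := hBinj h2
      rw [Prod.mk.injEq] at h3
      rw [← h3.1, ← h3.2]
      exact ⟨⟨algebraMap ℂ (InvRing (imprimitiveGroup m p 2)) k • s, Matrix.mulVec_smul _ _ _⟩,
        ⟨-(algebraMap ℂ (InvRing (imprimitiveGroup m p 2)) k • s'),
          by rw [Matrix.mulVec_neg, Matrix.mulVec_smul]⟩⟩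
    · rintro ⟨⟨s, rfl⟩, ⟨s', rfl⟩⟩
      have hwhom := isWeightedHomogeneous_linearCombination hm hmpq hw.hom
      refine ⟨C k⁻¹ * (Fintype.linearCombination (InvRing (imprimitiveGroup m p 2)) w s +
        swapVars (-Fintype.linearCombination (InvRing (imprimitiveGroup m p 2)) w s')), ?_, ?_⟩
      · rw [← hCk]
        exact Submodule.smul_mem _ _ ((hmem _).2 ⟨_, _, hwhom s, (hwhom s').neg, rfl⟩)
      · change z * _ = B (φ.mulVec s, φ.mulVec s')
        have hkk : (C k⁻¹ * C k : MvPolynomial (Fin 2) ℂ) = 1 := by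
          rw [← map_mul, inv_mul_cancel₀ hk, map_one]
        rw [hB, map_neg]
        linear_combination C k⁻¹ * hzL s - C k⁻¹ * hzLswap s' +
          (L (φ.mulVec s) + swapVars (L (φ.mulVec s'))) * hkk
  exact ⟨(Submodule.quotEquivOfEq _ _ hker).trans (Θ.quotKerEquivOfSurjective hΘsurj)⟩

end Presentation

/-! ### The matrix factorizations -/

section MatrixFactorizations

variable {R : Type} [CommRing R]

lemma xiMat_map {A : Type} [CommRing A] (f : R →+* A) (p : ℕ) (s t : R) (j : ℕ) :
    (xiMat p s t j).map f = xiMat p (f s) (f t) j := by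
  ext i l
  fin_cases i <;> fin_cases l <;> simp [xiMat, map_ofNat f 2]

lemma phiMat_map {A : Type} [CommRing A] (f : R →+* A) (p : ℕ) (s t : R) (j : ℕ) :
    (phiMat p s t j).map f = phiMat p (f s) (f t) j := by
  ext i l
  fin_cases i <;> fin_cases l <;> simp [phiMat, map_ofNat f 2]

lemma psiMat_map {A : Type} [CommRing A] (f : R →+* A) (p : ℕ) (s t : R) (j : ℕ) :
    (psiMat p s t j).map f = psiMat p (f s) (f t) j := by
  ext i l
  fin_cases i <;> fin_cases l <;> simp [psiMat, map_ofNat f 2]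

lemma exists_matrixFactorization_xiMat (k s t : R) {p j : ℕ} (hj : j ≤ p + 1) :
    ∃ ψ, xiMat p s t j * ψ = (k * (s * (t ^ 2 - 4 * s ^ p))) • 1 ∧
      ψ * xiMat p s t j = (k * (s * (t ^ 2 - 4 * s ^ p))) • 1 := by
  have h : s ^ j * s ^ (p + 1 - j) = s * s ^ p := by
    rw [← pow_add, Nat.add_sub_cancel' hj, pow_succ, mul_comm]
  refine ⟨!![k * (t * s), -(k * (2 * s ^ j)); -(k * (2 * s ^ (p + 1 - j))), k * t], ?_, ?_⟩ <;>
  · ext i l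
    fin_cases i <;> fin_cases l <;> simp [xiMat, Matrix.mul_apply, Fin.sum_univ_two]
    · linear_combination (-4 * k) * h
    · ring
    · ring
    · linear_combination (-4 * k) * h

lemma matrixFactorization_phiMat_psiMat (k s t : R) {p j : ℕ} (hj : j ≤ p) :
    phiMat p s t j * (k • psiMat p s t j) = (k * (s * (t ^ 2 - 4 * s ^ p))) • 1 ∧
      (k • psiMat p s t j) * phiMat p s t j = (k * (s * (t ^ 2 - 4 * s ^ p))) • 1 := by
  obtain ⟨l, rfl⟩ := Nat.exists_eq_add_of_le hj
  rw [phiMat, psiMat, show j + l - j = l by omega, show j + l + 1 - j = l + 1 by omega]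
  constructor <;>
  · ext i l
    fin_cases i <;> fin_cases l <;> simp [Matrix.mul_apply, Fin.sum_univ_two] <;> ring

lemma matrixFactorization_psiMat_phiMat (k s t : R) {p j : ℕ} (hj : j ≤ p) :
    psiMat p s t j * (k • phiMat p s t j) = (k * (s * (t ^ 2 - 4 * s ^ p))) • 1 ∧
      (k • phiMat p s t j) * psiMat p s t j = (k * (s * (t ^ 2 - 4 * s ^ p))) • 1 := by
  have h := matrixFactorization_phiMat_psiMat k s t hj
  rw [Matrix.mul_smul, Matrix.smul_mul] at h
  rw [Matrix.mul_smul, Matrix.smul_mul]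
  exact h.symm

end MatrixFactorizations

/-! ### Bases of the weight spaces -/

section Bases

variable {m p q : ℕ}

lemma isWeightBasis_monomials (hm : 0 < m) (hmpq : m = p * q) {c e j : ℕ} (hc : c < q)
    (he : e < q) (hj : j ≤ p) :
    IsWeightBasis p (wtDeg q m c (j * q + e))
      ![X 0 ^ c * X 1 ^ e * X 0 ^ ((p - j) * q), X 0 ^ c * X 1 ^ e * X 1 ^ (j * q)] where
  hom := by
    obtain ⟨l, rfl⟩ := Nat.exists_eq_add_of_le hj
    intro i
    fin_cases i
    · have h := isWeightedHomogeneous_X_pow_mul_X_pow (q := q) (m := m) (c + l * q) e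
      have h1 : wtDeg q m (c + l * q) e = wtDeg q m c (j * q + e) := by
        rw [wtDeg_eq_iff]
        push_cast
        refine ⟨⟨l, by ring⟩, ⟨1, ?_⟩⟩
        rw [hmpq]
        push_cast
        ring
      rw [h1] at h
      convert h using 1
      simp only [Nat.add_sub_cancel_left, Fin.zero_eta, Matrix.cons_val_zero]
      ring
    · have h := isWeightedHomogeneous_X_pow_mul_X_pow (q := q) (m := m) c (j * q + e)
      convert h using 1
      simp only [Fin.mk_one, Matrix.cons_val_one, Matrix.cons_val_fin_one]
      ring
  span := by
    intro f hf
    have h := mem_span_of_isWeightedHomogeneous hmpq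
      (A := invariantSubalgebra (imprimitiveGroup m p 2)) (sigma_one_mem hm hmpq)
      (sigma_two_mem hm hmpq) hc he hj hf
    obtain ⟨a, b, rfl⟩ := Submodule.mem_span_pair.1 h
    refine ⟨![a, b], ?_⟩
    rw [Fintype.linearCombination_apply, Fin.sum_univ_two]
    rfl
  inj := by
    rw [← LinearMap.ker_eq_bot, LinearMap.ker_eq_bot']
    intro r hr
    rw [Fintype.linearCombination_apply, Fin.sum_univ_two, invRing_smul_def,
      invRing_smul_def] at hr
    simp only [Matrix.cons_val_zero, Matrix.cons_val_one] at hr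
    obtain ⟨l, rfl⟩ := Nat.exists_eq_add_of_le hj
    rw [Nat.add_sub_cancel_left] at hr
    have hX : ∀ i : Fin 2, (X i : MvPolynomial (Fin 2) ℂ) ≠ 0 := fun i => X_ne_zero i
    have h1 : InvRing.incl _ (r 0) * X 0 ^ (l * q) + InvRing.incl _ (r 1) * X 1 ^ (j * q) = 0 := by
      have h2 : (X 0 ^ c * X 1 ^ e : MvPolynomial (Fin 2) ℂ) *
          (InvRing.incl _ (r 0) * X 0 ^ (l * q) + InvRing.incl _ (r 1) * X 1 ^ (j * q)) = 0 := by
        linear_combination hr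
      exact (mul_eq_zero.1 h2).resolve_left
        (mul_ne_zero (pow_ne_zero _ (hX 0)) (pow_ne_zero _ (hX 1)))
    have h2 : InvRing.incl _ (r 0) * X 1 ^ (l * q) + InvRing.incl _ (r 1) * X 0 ^ (j * q) = 0 := by
      have := congrArg swapVars h1
      simpa [swapVars_incl hm hmpq] using this
    have hD := X_pow_sub_X_pow_ne_zero hm
    have hpow : ∀ i : Fin 2, (X i ^ m : MvPolynomial (Fin 2) ℂ) = X i ^ (j * q) * X i ^ (l * q) :=
      fun i => by rw [← pow_add, ← add_mul, ← hmpq]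
    have h3 : InvRing.incl _ (r 0) * (X 0 ^ m - X 1 ^ m) = 0 := by
      rw [hpow, hpow]
      linear_combination X 0 ^ (j * q) * h1 - X 1 ^ (j * q) * h2
    have h4 : InvRing.incl _ (r 1) * (X 0 ^ m - X 1 ^ m) = 0 := by
      rw [hpow, hpow]
      linear_combination X 0 ^ (l * q) * h2 - X 1 ^ (l * q) * h1
    ext1 i
    fin_cases i
    · exact InvRing.incl_injective _ (((mul_eq_zero.1 h3).resolve_right hD).trans
        (map_zero _).symm)
    · exact InvRing.incl_injective _ (((mul_eq_zero.1 h4).resolve_right hD).trans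
        (map_zero _).symm)

lemma isWeightedHomogeneous_arrangement (hmpq : m = p * q) (k : ℂ) :
    IsWeightedHomogeneous (wt q m)
      (C k * (X 0 * X 1 * (X 0 ^ m - X 1 ^ m)) : MvPolynomial (Fin 2) ℂ) (wtDeg q m 1 1) := by
  have h := (isWeightedHomogeneous_X_pow_mul_X_pow (q := q) (m := m) 1 1).mul
    ((isWeightedHomogeneous_X_pow hmpq 0).sub (isWeightedHomogeneous_X_pow hmpq 1))
  rw [add_zero, pow_one, pow_one] at h
  exact h.C_mul k

lemma swapVars_arrangement (m : ℕ) (k : ℂ) :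
    swapVars (C k * (X 0 * X 1 * (X 0 ^ m - X 1 ^ m))) =
      -(C k * (X 0 * X 1 * (X 0 ^ m - X 1 ^ m))) := by
  simp only [map_mul, map_sub, map_pow, swapVars_C, swapVars_X_zero, swapVars_X_one]
  ring

end Bases

/-! ### The three families -/

section Families

variable {m p q : ℕ} {σ₁ σ₂ D : InvRing (imprimitiveGroup m p 2)}
  {c k : ℂ} {s t : InvRing (imprimitiveGroup m p 2) ⧸ Ideal.span {D}}

lemma wtDeg_mul_add_ne (hmpq : m = p * q) {i r j : ℕ} (hi : i < q)
    (hr : r < q) (hj : j < p) (hjp : 2 * j ≠ p) (hij : i < j * q + r) :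
    wtDeg q m i (j * q + r) ≠ wtDeg q m (j * q + r) i := by
  rw [Ne, wtDeg_eq_iff]
  push_cast
  rintro ⟨h1, h2⟩
  have h3 : (q : ℤ) ∣ i - r := by
    have : (i : ℤ) - r = (i - (j * q + r)) + q * j := by ring
    rw [this]
    exact dvd_add h1 (dvd_mul_right _ _)
  have h4 : (i : ℤ) - r = 0 := by
    refine Int.eq_zero_of_abs_lt_dvd h3 ?_
    rw [abs_lt]
    omega
  have h5 : (p : ℤ) ∣ 2 * j := by
    have hq0 : (q : ℤ) ≠ 0 := by omega
    have h6 : (p * q : ℤ) ∣ 2 * j * q := by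
      rw [hmpq] at h2
      push_cast at h2
      have : (2 * j * q : ℤ) = -((i - (j * q + r)) - (j * q + r - i)) := by
        linear_combination 2 * h4
      rw [this]
      exact (dvd_neg).2 h2
    exact (mul_dvd_mul_iff_right hq0).1 h6
  have hj0 : j ≠ 0 := by
    rintro rfl
    omega
  obtain ⟨n, hn⟩ := h5
  have hn1 : n < 2 := by
    by_contra! hcon
    nlinarith
  have hn0 : 0 < n := by
    by_contra! hcon
    nlinarith
  have : n = 1 := by omega
  rw [this] at hn
  omega

lemma givesSquareSummand_xMod (hm : 0 < m) (hmpq : m = p * q)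
    (h₁ : InvRing.incl _ σ₁ = (X 0 * X 1) ^ q) (h₂ : InvRing.incl _ σ₂ = X 0 ^ m + X 1 ^ m)
    (hD : D = c • (σ₁ * (σ₂ ^ 2 - 4 * σ₁ ^ p))) (hs : s = Ideal.Quotient.mk _ σ₁)
    (ht : t = Ideal.Quotient.mk _ σ₂) (hk : k ≠ 0) {i j : ℕ} (hj1 : 1 ≤ j) (hj : j ≤ p)
    (hi : i < q - 1) :
    GivesSquareSummand (imprimitiveGroup m p 2) (C k * (X 0 * X 1 * (X 0 ^ m - X 1 ^ m)))
      (resBoxRep m p i (j * q - 1)) (XMod p s t (p + 1 - j)) := by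
  obtain ⟨j, rfl⟩ : ∃ n, j = n + 1 := ⟨j - 1, by omega⟩
  obtain ⟨ψ, hψ, -⟩ := exists_matrixFactorization_xiMat (algebraMap ℂ _ c) σ₁ σ₂
    (p := p) (j := p + 1 - (j + 1)) (by omega)
  rw [← Algebra.smul_def, ← hD] at hψ
  have hb : (j + 1) * q - 1 = j * q + (q - 1) := by rw [add_mul]; omega
  have hb' : (j + 1) * q - 1 + 1 = (j + 1) * q + 0 := by rw [hb, add_mul]; omega
  have hab : wtDeg q m i ((j + 1) * q - 1) ≠ wtDeg q m ((j + 1) * q - 1) i := by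
    rw [hb, Ne, wtDeg_eq_iff]
    rintro ⟨h1, -⟩
    have h3 : (q : ℤ) ∣ (i + 1 : ℕ) := by
      have : ((i + 1 : ℕ) : ℤ) = (i - (j * q + (q - 1) : ℕ)) + q * (j + 1) := by
        rw [Nat.cast_add, Nat.cast_add, Nat.cast_mul, Nat.cast_sub (by omega)]
        push_cast
        ring
      rw [this]
      exact dvd_add h1 (dvd_mul_right _ _)
    have := Nat.le_of_dvd (by omega) (Int.natCast_dvd_natCast.1 h3)
    omega
  have hv := (isWeightBasis_monomials hm hmpq (c := i + 1) (e := 0) (j := j + 1) (by omega)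
    (by omega) hj).neg_snd.swap
  have hw := isWeightBasis_monomials hm hmpq (c := i) (e := q - 1) (j := j) (by omega)
    (by omega) (by omega)
  rw [← hb'] at hv
  rw [← hb] at hw
  refine givesSquareSummand_of_basis hm hmpq (isBoxType_resBoxRep m p i _) hab
    (isWeightedHomogeneous_arrangement hmpq k) (swapVars_arrangement m k) hv hw.swap hψ hk ?_
    (by rw [xiMat_map, hs, ht])
  obtain ⟨l, rfl⟩ := Nat.exists_eq_add_of_le hj
  obtain ⟨q, rfl⟩ : ∃ n, q = n + 1 := ⟨q - 1, by omega⟩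
  intro n
  have e1 : j + 1 + l - (j + 1) = l := by omega
  have e2 : j + 1 + l - j = l + 1 := by omega
  have e3 : j + 1 + l + 1 - (j + 1) = l + 1 := by omega
  have e4 : j + 1 + l + 1 - (l + 1) = j + 1 := by omega
  rw [e1, e2, e3, Nat.add_sub_cancel]
  fin_cases n <;>
    simp only [Fin.sum_univ_two, invRing_smul_def, xiMat, e4, map_mul, map_pow, h₁, h₂, hmpq,
      Fin.zero_eta, Fin.mk_one, Matrix.of_apply, Matrix.cons_val', Matrix.cons_val_zero,
      Matrix.cons_val_one, Matrix.cons_val_fin_one, map_ofNat] <;> ring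

lemma givesSquareSummand_kMod (hm : 0 < m) (hmpq : m = p * q)
    (h₁ : InvRing.incl _ σ₁ = (X 0 * X 1) ^ q) (h₂ : InvRing.incl _ σ₂ = X 0 ^ m + X 1 ^ m)
    (hD : D = c • (σ₁ * (σ₂ ^ 2 - 4 * σ₁ ^ p))) (hs : s = Ideal.Quotient.mk _ σ₁)
    (ht : t = Ideal.Quotient.mk _ σ₂) (hk : k ≠ 0) {i j r : ℕ} (hj : j < p) (hjp : 2 * j ≠ p)
    (hi : i < q - 1) (hr : r < q - 1) (hij : i < j * q + r) :
    GivesSquareSummand (imprimitiveGroup m p 2) (C k * (X 0 * X 1 * (X 0 ^ m - X 1 ^ m)))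
      (resBoxRep m p i (j * q + r)) (KMod p s t j) := by
  have hφ := (matrixFactorization_phiMat_psiMat (algebraMap ℂ _ c) σ₁ σ₂ hj.le).1
  rw [← Algebra.smul_def, ← hD] at hφ
  have hv := (isWeightBasis_monomials hm hmpq (c := i + 1) (e := r + 1) (j := j) (by omega)
    (by omega) hj.le).neg_snd
  have hw := isWeightBasis_monomials hm hmpq (c := i) (e := r) (j := j) (by omega)
    (by omega) hj.le
  refine givesSquareSummand_of_basis hm hmpq (isBoxType_resBoxRep m p i _)
    (wtDeg_mul_add_ne hmpq (by omega) (by omega) hj hjp hij)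
    (isWeightedHomogeneous_arrangement hmpq k) (swapVars_arrangement m k) hv hw hφ hk ?_
    (by rw [phiMat_map, hs, ht])
  obtain ⟨l, rfl⟩ := Nat.exists_eq_add_of_le hj.le
  intro n
  rw [Nat.add_sub_cancel_left]
  fin_cases n <;>
    simp only [Fin.sum_univ_two, invRing_smul_def, phiMat, Nat.add_sub_cancel_left, map_mul,
      map_pow, h₁, h₂, hmpq,
      Fin.zero_eta, Fin.mk_one, Matrix.of_apply, Matrix.cons_val', Matrix.cons_val_zero,
      Matrix.cons_val_one, Matrix.cons_val_fin_one, map_ofNat] <;> ring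

lemma givesSquareSummand_nMod (hm : 0 < m) (hmpq : m = p * q)
    (h₁ : InvRing.incl _ σ₁ = (X 0 * X 1) ^ q) (h₂ : InvRing.incl _ σ₂ = X 0 ^ m + X 1 ^ m)
    (hD : D = c • (σ₁ * (σ₂ ^ 2 - 4 * σ₁ ^ p))) (hs : s = Ideal.Quotient.mk _ σ₁)
    (ht : t = Ideal.Quotient.mk _ σ₂) (hk : k ≠ 0) {j : ℕ} (hj1 : 1 ≤ j) (hj : j < p)
    (hjp : 2 * j ≠ p) :
    GivesSquareSummand (imprimitiveGroup m p 2) (C k * (X 0 * X 1 * (X 0 ^ m - X 1 ^ m)))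
      (resBoxRep m p (q - 1) ((j + 1) * q - 1)) (NMod p s t j) := by
  have hq0 : 0 < q := Nat.pos_of_ne_zero (by rintro rfl; omega)
  have hψ := (matrixFactorization_psiMat_phiMat (algebraMap ℂ _ c) σ₁ σ₂ hj.le).1
  rw [← Algebra.smul_def, ← hD] at hψ
  have hb : (j + 1) * q - 1 = j * q + (q - 1) := by rw [add_mul]; omega
  have hv := isWeightBasis_monomials hm hmpq (c := 0) (e := 0) (j := j) hq0 hq0 hj.le
  have hw := (isWeightBasis_monomials hm hmpq (c := q - 1) (e := q - 1) (j := j) (by omega)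
    (by omega) hj.le).neg_snd
  have hdeg : wtDeg q m 0 (j * q + 0) = wtDeg q m (q - 1 + 1) (j * q + (q - 1) + 1) := by
    rw [wtDeg_eq_iff, show q - 1 + 1 = q by omega, show j * q + (q - 1) + 1 = j * q + q by omega]
    push_cast
    exact ⟨⟨-1, by ring⟩, ⟨0, by ring⟩⟩
  rw [hdeg] at hv
  have hqq : q ≤ j * q := Nat.le_mul_of_pos_left q hj1
  rw [hb]
  refine givesSquareSummand_of_basis hm hmpq (isBoxType_resBoxRep m p _ _)
    (wtDeg_mul_add_ne hmpq (by omega) (by omega) hj hjp (by omega))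
    (isWeightedHomogeneous_arrangement hmpq k) (swapVars_arrangement m k) hv hw hψ hk ?_
    (by rw [psiMat_map, hs, ht])
  obtain ⟨l, rfl⟩ := Nat.exists_eq_add_of_le hj.le
  obtain ⟨q, rfl⟩ : ∃ n, q = n + 1 := ⟨q - 1, by omega⟩
  intro n
  have e1 : j + l + 1 - j = l + 1 := by omega
  rw [Nat.add_sub_cancel_left, Nat.add_sub_cancel]
  fin_cases n <;>
    simp only [Fin.sum_univ_two, invRing_smul_def, psiMat, e1, map_mul, map_neg,
      map_pow, h₁, h₂, hmpq,
      Fin.zero_eta, Fin.mk_one, Matrix.of_apply, Matrix.cons_val', Matrix.cons_val_zero,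
      Matrix.cons_val_one, Matrix.cons_val_fin_one, map_ofNat] <;> ring

end Families

end ReflectionMCM

theorem mainTheorem6 (m p q : ℕ) (hm : 0 < m) (hmpq : m = p * q) (hp : Even p) (hne : m ≠ p)
    (α : Submodule ℂ (Fin 2 → ℂ) → MvPolynomial (Fin 2) ℂ)
    (hα : ∀ H ∈ reflectingHyperplanes (imprimitiveGroup m p 2), IsDefiningForm H (α H)) :
    ∃ σ₁ σ₂ Δ : InvRing (imprimitiveGroup m p 2),
      -- basic invariants
      InvRing.incl _ σ₁ = (X 0 * X 1) ^ q ∧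
      InvRing.incl _ σ₂ = X 0 ^ m + X 1 ^ m ∧
      AlgebraicIndependent ℂ ![σ₁, σ₂] ∧
      Algebra.adjoin ℂ {σ₁, σ₂} = ⊤ ∧
      -- the discriminant, and its type as a plane curve singularity
      InvRing.incl _ Δ = discriminantPoly (imprimitiveGroup m p 2) α ∧
      (∃ c : ℂ, c ≠ 0 ∧ Δ = c • (σ₁ * (σ₂ ^ 2 - 4 * σ₁ ^ p))) ∧
      (∃ F : MvPolynomial (Fin 2) ℂ, aeval ![σ₁, σ₂] F = Δ ∧
        IsDSingularity (p + 2) (F : MvPowerSeries (Fin 2) ℂ)) ∧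
      ∃ s t : InvRing (imprimitiveGroup m p 2) ⧸ Ideal.span {Δ},
        s = Ideal.Quotient.mk _ σ₁ ∧ t = Ideal.Quotient.mk _ σ₂ ∧
        -- the modules are Cohen-Macaulay over `R/(Δ)`
        (∀ j ≤ p,
          IsCohenMacaulayModule (InvRing (imprimitiveGroup m p 2) ⧸ Ideal.span {Δ})
            (XMod p s t j) ∧
          IsCohenMacaulayModule (InvRing (imprimitiveGroup m p 2) ⧸ Ideal.span {Δ})
            (KMod p s t j) ∧
          IsCohenMacaulayModule (InvRing (imprimitiveGroup m p 2) ⧸ Ideal.span {Δ})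
            (NMod p s t j)) ∧
        -- the `X` family
        (∀ i j : ℕ, 1 ≤ j → j ≤ p → i < q - 1 →
          GivesSquareSummand (imprimitiveGroup m p 2)
            (arrangementPoly (imprimitiveGroup m p 2) α)
            (resBoxRep m p i (j * q - 1)) (XMod p s t (p + 1 - j))) ∧
        -- the `K` family
        (∀ i j r : ℕ, j ≤ p - 1 → j ≠ p / 2 → i < q - 1 → r < q - 1 → i < j * q + r →
          GivesSquareSummand (imprimitiveGroup m p 2)
            (arrangementPoly (imprimitiveGroup m p 2) α)
            (resBoxRep m p i (j * q + r)) (KMod p s t j)) ∧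
        -- the `N` family
        (∀ j : ℕ, 1 ≤ j → j ≤ p - 1 → j ≠ p / 2 →
          GivesSquareSummand (imprimitiveGroup m p 2)
            (arrangementPoly (imprimitiveGroup m p 2) α)
            (resBoxRep m p (q - 1) ((j + 1) * q - 1)) (NMod p s t j)) := by
  have hp0 : p ≠ 0 := by
    rintro rfl
    rw [zero_mul] at hmpq
    omega
  have hp2 : 2 ≤ p := by
    obtain ⟨l, hl⟩ := hp
    omega
  have hq2 : 2 ≤ q := by
    rcases q with _ | _ | q
    · rw [mul_zero] at hmpq
      omega
    · exact absurd (by rw [hmpq, zero_add, mul_one]) hne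
    · omega
  obtain ⟨k, hk, hz⟩ := exists_arrangementPoly_eq hm hmpq hq2 hα
  obtain ⟨c, hc, hdisc⟩ := exists_discriminantPoly_eq hm hmpq hq2 hα
  obtain ⟨σ₁, h₁⟩ : ∃ σ, InvRing.incl (imprimitiveGroup m p 2) σ = (X 0 * X 1) ^ q :=
    ⟨⟨_, sigma_one_mem hm hmpq⟩, rfl⟩
  obtain ⟨σ₂, h₂⟩ : ∃ σ, InvRing.incl (imprimitiveGroup m p 2) σ = X 0 ^ m + X 1 ^ m :=
    ⟨⟨_, sigma_two_mem hm hmpq⟩, rfl⟩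
  obtain ⟨D, hD⟩ : ∃ D, D = c • (σ₁ * (σ₂ ^ 2 - 4 * σ₁ ^ p)) := ⟨_, rfl⟩
  have hDincl : InvRing.incl _ D = C c * ((X 0 * X 1) ^ q * (X 0 ^ m - X 1 ^ m) ^ 2) := by
    have hpow : ((X 0 * X 1 : MvPolynomial (Fin 2) ℂ) ^ q) ^ p = X 0 ^ m * X 1 ^ m := by
      rw [← pow_mul, mul_comm q p, ← hmpq, mul_pow]
    rw [hD, map_smul, smul_eq_C_mul, map_mul, map_sub, map_mul, map_pow, map_pow, h₁, h₂, hpow,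
      map_ofNat]
    ring
  have hD0 : D ≠ 0 := fun h => by
    rw [h, map_zero] at hDincl
    exact mul_ne_zero (C_ne_zero.2 hc) (mul_ne_zero
      (pow_ne_zero _ (mul_ne_zero (X_ne_zero 0) (X_ne_zero 1)))
      (pow_ne_zero _ (X_pow_sub_X_pow_ne_zero hm))) hDincl.symm
  have := isDomain_invRing (imprimitiveGroup m p 2)
  have := isNoetherianRing_invRing hm hmpq
  have := uniqueFactorizationMonoid_invRing hm hmpq
  have hdim := (ringKrullDim_invRing hm hmpq).le
  have hD' : D = algebraMap ℂ _ c * (σ₁ * (σ₂ ^ 2 - 4 * σ₁ ^ p)) := by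
    rw [hD, Algebra.smul_def]
  refine ⟨σ₁, σ₂, D, h₁, h₂, algebraicIndependent_sigma hm hmpq h₁ h₂,
    adjoin_eq_top hm hmpq h₁ h₂, hDincl.trans hdisc.symm, ⟨c, hc, hD⟩,
    ⟨C c * (X 0 * (X 1 ^ 2 - C 4 * X 0 ^ p)), ?_, isDSingularity_discriminant hp2 hc⟩,
    _, _, rfl, rfl, ?_, ?_, ?_, ?_⟩
  · rw [hD']
    simp [map_ofNat (algebraMap ℂ (InvRing (imprimitiveGroup m p 2))) 4]
  · intro j hj
    refine ⟨?_, ?_, ?_⟩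
    · obtain ⟨ψ, h1, h2⟩ := exists_matrixFactorization_xiMat (algebraMap ℂ _ c) σ₁ σ₂
        (p := p) (j := j) (by omega)
      rw [← hD'] at h1 h2
      have := isCohenMacaulayModule_coker hdim hD0 h1 h2
      rwa [xiMat_map] at this
    · obtain ⟨h1, h2⟩ := matrixFactorization_phiMat_psiMat (algebraMap ℂ _ c) σ₁ σ₂ hj
      rw [← hD'] at h1 h2
      have := isCohenMacaulayModule_coker hdim hD0 h1 h2
      rwa [phiMat_map] at this
    · obtain ⟨h1, h2⟩ := matrixFactorization_psiMat_phiMat (algebraMap ℂ _ c) σ₁ σ₂ hj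
      rw [← hD'] at h1 h2
      have := isCohenMacaulayModule_coker hdim hD0 h1 h2
      rwa [psiMat_map] at this
  · intro i j hj1 hj hi
    rw [hz]
    exact givesSquareSummand_xMod hm hmpq h₁ h₂ hD rfl rfl hk hj1 hj hi
  · intro i j r hj hjp hi hr hij
    rw [hz]
    obtain ⟨l, hl⟩ := hp
    exact givesSquareSummand_kMod hm hmpq h₁ h₂ hD rfl rfl hk (by omega) (by omega) hi hr hij
  · intro j hj1 hj hjp
    rw [hz]
    obtain ⟨l, hl⟩ := hp
    exact givesSquareSummand_nMod hm hmpq h₁ h₂ hD rfl rfl hk hj1 (by omega) (by omega)
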